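/- Let $\mathbb H=\{(x,y)\in\mathbb R^2: y>0\}$ carry the hyperbolic metric $(dx^2+dy^2)/y^2$, and for a regular curve $\gamma$ in $\mathbb H$ let $\kappa$ be its hyperbolic geodesic curvature and $\int\kappa^2\,ds$ its elastic energy, where $s$ is hyperbolic arclength. A smooth regular curve is called an elastica if it is a critical point of the elastic energy, i.e. if the first variation of the energy vanishes for all smooth compactly supported variations. All elastica $\gamma:\mathbb R\to\mathbb H$ below are parametrised by hyperbolic arclength $s$; limits are taken in $\mathbb R^2$. Let $\alpha>0$. (1) For every $x\in\mathbb R\setminus\{\alpha,-\alpha\}$ there is exactly one elastica $\gamma:\mathbb R\to\mathbb H$ of finite elastic energy $\int_{\mathbb R}\kappa^2\,ds<\infty$ such that $$\gamma(0)=(0,\alpha),\qquad \gamma'(0)=(\alpha,0),\qquad \lim_{s\to\infty}\gamma(s)=(x,0).$$ It is of asymptotic geodesic type: there are $s_0\in\mathbb R$ and a sign, both independent of $s$, such that $\kappa(s)=\pm\dfrac{2}{\cosh(s+s_0)}$ for all $s\in\mathbb R$. (2) If $x=\alpha$ or $x=-\alpha$, there is exactly one half circle $C\subset\mathbb H$ with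 centre on the $x$-axis which connects $(0,\alpha)$ with $(x,0)$, i.e. which passes through $(0,\alpha)$ and has $(x,0)$ in its closure. It is an elastica: there is exactly one elastica $\gamma:\mathbb R\to\mathbb H$ of finite elastic energy with $\gamma(0)=(0,\alpha)$, $\gamma'(0)=(x,0)$ and $\gamma(s)\to(x,0)$ as $s\to\infty$, and its image is $C$. -/

import Mathlib

open Set Filter Topology MeasureTheory
open scoped ContDiff

noncomputable section

namespace HypElastica

/-- The hyperbolic metric `(dx² + dy²) / y²` of the upper half plane at `z`, applied to the
tangent vectors `v` and `w`. The point `(x, y)` is written as the complex number `x + i y`. -/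
def hypInner (z v w : ℂ) : ℝ := (v.re * w.re + v.im * w.im) / z.im ^ 2

/-- The hyperbolic length of a tangent vector `v` at `z`. -/
def hypNorm (z v : ℂ) : ℝ := Real.sqrt (hypInner z v v)

/-- The covariant derivative along the curve `c` of the vector field `V` along `c`, for the
Levi-Civita connection of the hyperbolic metric. The nonzero Christoffel symbols at `(x, y)` are
`Γ¹₁₂ = Γ¹₂₁ = -1/y`, `Γ²₁₁ = 1/y`, `Γ²₂₂ = -1/y`. -/
def covDeriv (c V : ℝ → ℂ) (t : ℝ) : ℂ :=
  ⟨(deriv V t).re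
      - ((deriv c t).re * (V t).im + (deriv c t).im * (V t).re) / (c t).im,
   (deriv V t).im
      + ((deriv c t).re * (V t).re - (deriv c t).im * (V t).im) / (c t).im⟩

/-- The unit normal of the curve `c` for the hyperbolic metric: the velocity rotated by a quarter
turn counterclockwise and normalised. -/
def unitNormal (c : ℝ → ℂ) (t : ℝ) : ℂ :=
  ((hypNorm (c t) (deriv c t))⁻¹ : ℝ) • (Complex.I * deriv c t)

/-- The hyperbolic geodesic curvature of a regular curve `c`, in any parametrisation. -/
def curvature (c : ℝ → ℂ) (t : ℝ) : ℝ :=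
  hypInner (c t) (covDeriv c (deriv c) t) (unitNormal c t)
    / hypInner (c t) (deriv c t) (deriv c t)

/-- The density of the elastic energy: `κ² ds`, with `ds` the hyperbolic length element. -/
def energyDensity (c : ℝ → ℂ) (t : ℝ) : ℝ :=
  curvature c t ^ 2 * hypNorm (c t) (deriv c t)

/-- The elastic energy of the restriction of `c` to `[a, b]`. -/
def elasticEnergy (a b : ℝ) (c : ℝ → ℂ) : ℝ := ∫ t in a..b, energyDensity c t

/-- A curve in the upper half plane, seen as a curve in `ℂ`. -/
def toC (γ : ℝ → UpperHalfPlane) : ℝ → ℂ := fun t => (γ t : ℂ)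

/-- A (free) elastic curve, or elastica: a smooth regular curve in the hyperbolic half plane that
is a critical point of the elastic energy, i.e. on every interval `[a, b]` the first variation
of the energy vanishes for every smooth variation field `φ` with support in `(a, b)`.
For small `ε` the curve `γ + ε φ` is again a regular curve in the half plane. -/
structure IsElasticCurve (γ : ℝ → UpperHalfPlane) : Prop where
  smooth : ContDiff ℝ ∞ (toC γ)
  regular : ∀ t, deriv (toC γ) t ≠ 0
  critical : ∀ a b : ℝ, a < b → ∀ φ : ℝ → ℂ, ContDiff ℝ ∞ φ → tsupport φ ⊆ Ioo a b →
    HasDerivAt (fun ε : ℝ => elasticEnergy a b (fun t => toC γ t + (ε : ℂ) * φ t)) 0 0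

/-- Parametrisation by hyperbolic arclength. -/
def IsArclengthParam (γ : ℝ → UpperHalfPlane) : Prop :=
  ∀ s, hypNorm (toC γ s) (deriv (toC γ) s) = 1

/-- The elastic energy of the whole curve is finite (its density is nonnegative). -/
def HasFiniteEnergy (γ : ℝ → UpperHalfPlane) : Prop :=
  Integrable (energyDensity (toC γ)) volume

/-- An elastic curve of finite energy, parametrised by hyperbolic arclength, which starts at
`(0, α)` with velocity `(v, 0)` and tends to the boundary point `(x, 0)` in the Euclidean
plane as the arclength tends to `∞`. -/
structure IsFiniteElasticaTo (α v x : ℝ) (γ : ℝ → UpperHalfPlane) : Prop where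
  elastic : IsElasticCurve γ
  arclength : IsArclengthParam γ
  finiteEnergy : HasFiniteEnergy γ
  start : toC γ 0 = ⟨0, α⟩
  velocity : deriv (toC γ) 0 = ⟨v, 0⟩
  limit : Tendsto (toC γ) atTop (𝓝 ⟨x, 0⟩)

/-- Asymptotic geodesic type: the curvature is `2 / cosh (s + s₀)` or `-2 / cosh (s + s₀)`. -/
def IsAsymptoticGeodesic (γ : ℝ → UpperHalfPlane) : Prop :=
  ∃ s₀ : ℝ, (∀ s, curvature (toC γ) s = 2 / Real.cosh (s + s₀)) ∨
    (∀ s, curvature (toC γ) s = -(2 / Real.cosh (s + s₀)))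

/-- Half circles in the upper half plane with centre on the `x`-axis. -/
def IsHalfCircle (C : Set UpperHalfPlane) : Prop :=
  ∃ m r : ℝ, 0 < r ∧ C = {z | (z.re - m) ^ 2 + z.im ^ 2 = r ^ 2}

/-- `C` is a half circle, centred on the `x`-axis, which connects the interior point `(0, α)` with
the boundary point `(x, 0)`: it passes through the former and ends at the latter. -/
def IsHalfCircleConnecting (α x : ℝ) (C : Set UpperHalfPlane) : Prop :=
  IsHalfCircle C ∧ (∃ z ∈ C, (z : ℂ) = ⟨0, α⟩) ∧
    (⟨x, 0⟩ : ℂ) ∈ closure ((fun z : UpperHalfPlane => (z : ℂ)) '' C)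

end HypElastica

end

/-!
A unit speed curve `c` in the half plane satisfies the Frenet equations `c' = y ζ`,
`ζ' = i ζ (κ - Re ζ)` with `y = Im c` and `|ζ| = 1` (`IsUnitSpeed`). Writing a variation field as
`(g + i f) c'`, the first variation of the energy density is
`(2 κ'' + κ³ - 2 κ) f + (2 κ f' - 2 κ' f + κ² g)'` (`IsUnitSpeed.lagrVar_eq`), so that `c` is an
elastica if and only if `2 κ'' + κ³ - 2 κ = 0`.

This equation has the first integral `κ'² + κ⁴ / 4 - κ²`, which vanishes if the energy is finite
(`deriv_curvature_sq`); hence `κ = 0` or `κ = ± 2 / cosh (s + s₀)` (`curvature_classification`).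
Curvature, initial point and initial direction determine the curve (`IsUnitSpeed.unique`), so it
remains to find one curve for each of these functions and to read off its endpoint.

For `κ = 0` this is the half circle `|z| = α`, which ends at `(±α, 0)`. For
`κ = 2 τ / cosh (s + s₀)`, `τ = ± 1`, the catenary `τ s + i cosh (s + s₀)` has this curvature, and
Möbius transformations preserve it (`IsUnitSpeed.moebius`). Moving the start of the catenary to
`(0, α)` with horizontal direction `σ = ± 1` sends `∞`, the limit of the catenary, to `x = σ ρ α`,
where `ρ = m / n` with `m² - n² = σ τ`, `2 m n = sinh s₀` and `m² + n² = cosh s₀`. Thus `ρ² ≠ 1`,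
the sign of `ρ² - 1` is `σ τ`, and `sinh s₀ = 2 ρ / |ρ² - 1|`: the endpoints other than `(±α, 0)`
correspond bijectively to the pairs `(τ, s₀)` for which the curve has a finite endpoint.
-/

open Set Filter Topology MeasureTheory
open scoped ContDiff

namespace HypElastica

/-! ### The energy density and its first variation -/

/-- Differentiation under the integral sign on a compact interval, for an integrand which is
continuously differentiable in the parameter on an open set of pairs (parameter, time). -/
theorem hasDerivAt_integral_of_continuousOn {F F' : ℝ → ℝ → ℝ} {U : Set (ℝ × ℝ)} {a b x₀ : ℝ}
    (hab : a ≤ b) (hU : IsOpen U) (hsub : {x₀} ×ˢ Icc a b ⊆ U)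
    (hF : ContinuousOn (fun p : ℝ × ℝ => F p.1 p.2) U)
    (hF' : ContinuousOn (fun p : ℝ × ℝ => F' p.1 p.2) U)
    (hd : ∀ p ∈ U, HasDerivAt (fun x => F x p.2) (F' p.1 p.2) p.1) :
    HasDerivAt (fun x => ∫ t in a..b, F x t) (∫ t in a..b, F' x₀ t) x₀ := by
  obtain ⟨u, v, hu, -, hxu, hv, huv⟩ :=
    generalized_tube_lemma (isCompact_singleton (x := x₀)) isCompact_Icc hU hsub
  obtain ⟨r, hr, hru⟩ := Metric.isOpen_iff.1 hu x₀ (hxu rfl)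
  have hmem : ∀ x ∈ Metric.closedBall x₀ (r / 2), ∀ t ∈ Icc a b, (x, t) ∈ U := fun x hx t ht =>
    huv ⟨hru (Metric.closedBall_subset_ball (by linarith) hx), hv ht⟩
  have hslice : ∀ G : ℝ → ℝ → ℝ, ContinuousOn (fun p : ℝ × ℝ => G p.1 p.2) U →
      ∀ x ∈ Metric.closedBall x₀ (r / 2), ContinuousOn (G x) (Icc a b) := fun G hG x hx =>
    hG.comp (f := fun t => (x, t)) (by fun_prop) fun t ht => hmem x hx t ht
  have hI : uIoc a b ⊆ Icc a b := by rw [uIoc_of_le hab]; exact Ioc_subset_Icc_self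
  have hx₀ : x₀ ∈ Metric.closedBall x₀ (r / 2) := Metric.mem_closedBall_self (by positivity)
  obtain ⟨M, hM⟩ := ((isCompact_closedBall x₀ (r / 2)).prod
    (isCompact_Icc (a := a) (b := b))).exists_bound_of_continuousOn
      (hF'.mono fun p hp => hmem p.1 hp.1 p.2 hp.2)
  have hball : Metric.closedBall x₀ (r / 2) ∈ 𝓝 x₀ := Metric.closedBall_mem_nhds _ (by positivity)
  refine (intervalIntegral.hasDerivAt_integral_of_dominated_loc_of_deriv_le (bound := fun _ => M)
    hball ?_ ?_ ?_ ?_ ?_ ?_).2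
  · filter_upwards [hball] with x hx
    exact ((hslice F hF x hx).mono hI).aestronglyMeasurable measurableSet_uIoc
  · exact (hslice F hF x₀ hx₀).intervalIntegrable_of_Icc hab
  · exact ((hslice F' hF' x₀ hx₀).mono hI).aestronglyMeasurable measurableSet_uIoc
  · exact .of_forall fun t ht x hx => hM (x, t) ⟨hx, hI ht⟩
  · exact intervalIntegrable_const
  · exact .of_forall fun t ht x hx => hd (x, t) (hmem x hx t (hI ht))

/-- The numerator of the curvature: a curve with height `y`, velocity `v` and acceleration `a` has
hyperbolic geodesic curvature `curvNum y v a / |v|³`. -/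
def curvNum (y : ℝ) (v a : ℂ) : ℝ :=
  y * (v.re * a.im - v.im * a.re) + v.re * (v.re ^ 2 + v.im ^ 2)

/-- The Lagrangian of the elastic energy, as a function of the height `y`, the velocity `v` and the
acceleration `a`. -/
noncomputable def lagr (y : ℝ) (v a : ℂ) : ℝ :=
  curvNum y v a ^ 2 / (y * √(v.re ^ 2 + v.im ^ 2) ^ 5)

/-- The derivative of `curvNum` at `(y, v, a)` in the direction `(h, v₁, a₁)`. -/
def curvNumVar (y : ℝ) (v a : ℂ) (h : ℝ) (v₁ a₁ : ℂ) : ℝ :=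
  h * (v.re * a.im - v.im * a.re)
    + y * (v₁.re * a.im + v.re * a₁.im - v₁.im * a.re - v.im * a₁.re)
    + v₁.re * (v.re ^ 2 + v.im ^ 2) + v.re * (2 * (v.re * v₁.re + v.im * v₁.im))

/-- The derivative of `lagr` at `(y, v, a)` in the direction `(h, v₁, a₁)`. -/
noncomputable def lagrVar (y : ℝ) (v a : ℂ) (h : ℝ) (v₁ a₁ : ℂ) : ℝ :=
  2 * curvNum y v a * curvNumVar y v a h v₁ a₁ / (y * √(v.re ^ 2 + v.im ^ 2) ^ 5)
    - curvNum y v a ^ 2 * (h / (y ^ 2 * √(v.re ^ 2 + v.im ^ 2) ^ 5)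
      + 5 * (v.re * v₁.re + v.im * v₁.im) / (y * √(v.re ^ 2 + v.im ^ 2) ^ 7))

theorem sq_add_sq_pos {v : ℂ} (hv : v ≠ 0) : 0 < v.re ^ 2 + v.im ^ 2 := by
  have := Complex.normSq_pos.2 hv
  rw [Complex.normSq_apply] at this
  nlinarith

theorem hypNorm_eq {z : ℂ} (hz : 0 < z.im) (v : ℂ) :
    hypNorm z v = √(v.re ^ 2 + v.im ^ 2) / z.im := by
  rw [hypNorm, hypInner, Real.sqrt_div (by nlinarith [mul_self_nonneg v.re, mul_self_nonneg v.im]),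
    Real.sqrt_sq hz.le]
  ring_nf

theorem curvature_eq {c : ℝ → ℂ} {t : ℝ} (hy : 0 < (c t).im) (hv : deriv c t ≠ 0) :
    curvature c t = curvNum (c t).im (deriv c t) (deriv (deriv c) t)
      / √((deriv c t).re ^ 2 + (deriv c t).im ^ 2) ^ 3 := by
  have h2 := sq_add_sq_pos hv
  have hs := Real.sqrt_pos.2 h2
  have hsq := Real.sq_sqrt h2.le
  have hn : (deriv c t).re * (deriv c t).re + (deriv c t).im * (deriv c t).im
      = √((deriv c t).re ^ 2 + (deriv c t).im ^ 2) ^ 2 := by rw [hsq]; ring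
  simp only [curvature, unitNormal, hypNorm_eq hy, hypInner, covDeriv, hn]
  simp only [Complex.real_smul, Complex.mul_re, Complex.mul_im, Complex.ofReal_re,
    Complex.ofReal_im, Complex.I_re, Complex.I_im, curvNum]
  generalize √((deriv c t).re ^ 2 + (deriv c t).im ^ 2) = w at *
  field_simp
  ring

theorem energyDensity_eq {c : ℝ → ℂ} {t : ℝ} (hy : 0 < (c t).im) (hv : deriv c t ≠ 0) :
    energyDensity c t = lagr (c t).im (deriv c t) (deriv (deriv c) t) := by
  have hs := Real.sqrt_pos.2 (sq_add_sq_pos hv)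
  rw [energyDensity, curvature_eq hy hv, hypNorm_eq hy, lagr]
  field_simp

theorem hasDerivAt_lagr {y h e : ℝ} {v a v₁ a₁ : ℂ} (hy : 0 < y + e * h)
    (hv : v + e * v₁ ≠ 0) :
    HasDerivAt (fun ε : ℝ => lagr (y + ε * h) (v + ε * v₁) (a + ε * a₁))
      (lagrVar (y + e * h) (v + e * v₁) (a + e * a₁) h v₁ a₁) e := by
  have h2 := sq_add_sq_pos hv
  have lin : ∀ p q : ℝ, HasDerivAt (fun ε : ℝ => p + ε * q) q e := fun p q => by
    simpa using ((hasDerivAt_id e).mul_const q).const_add p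
  have hY := lin y h
  have hvr := lin v.re v₁.re
  have hvi := lin v.im v₁.im
  have har := lin a.re a₁.re
  have hai := lin a.im a₁.im
  simp only [lagr, lagrVar, curvNum, curvNumVar, Complex.add_re, Complex.add_im, Complex.mul_re,
    Complex.mul_im, Complex.ofReal_re, Complex.ofReal_im, zero_mul, sub_zero, add_zero] at h2 ⊢
  have hS := (hvr.fun_pow 2).fun_add (hvi.fun_pow 2)
  have hP := (hY.fun_mul ((hvr.fun_mul hai).fun_sub (hvi.fun_mul har))).fun_add (hvr.fun_mul hS)
  have hR := hS.sqrt h2.ne'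
  have hs := Real.sqrt_pos.2 h2
  have key := (hP.fun_pow 2).fun_div (hY.fun_mul (hR.fun_pow 5)) (by positivity)
  refine key.congr_deriv ?_
  generalize √((v.re + e * v₁.re) ^ 2 + (v.im + e * v₁.im) ^ 2) = w at *
  generalize v.re + e * v₁.re = p at *
  generalize v.im + e * v₁.im = q at *
  generalize y + e * h = y at *
  generalize a.re + e * a₁.re = ar at *
  generalize a.im + e * a₁.im = ai at *
  field_simp
  ring

/-- Along a variation `c + ε φ` of a smooth regular curve, the first variation of the elastic
energy is the integral of the first variation of the Lagrangian. -/
theorem hasDerivAt_elasticEnergy {c φ : ℝ → ℂ} (hc : ContDiff ℝ ∞ c) (hφ : ContDiff ℝ ∞ φ)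
    (hy : ∀ t, 0 < (c t).im) (hv : ∀ t, deriv c t ≠ 0) {a b : ℝ} (hab : a ≤ b) :
    HasDerivAt (fun ε : ℝ => elasticEnergy a b (fun t => c t + (ε : ℂ) * φ t))
      (∫ t in a..b, lagrVar (c t).im (deriv c t) (deriv (deriv c) t)
        (φ t).im (deriv φ t) (deriv (deriv φ) t)) 0 := by
  have smooth_deriv : ∀ {f : ℝ → ℂ}, ContDiff ℝ ∞ f → ContDiff ℝ ∞ (deriv f) := fun hf =>
    (contDiff_infty_iff_deriv.1 hf).2
  have hc1 := smooth_deriv hc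
  have hφ1 := smooth_deriv hφ
  have C0 := hc.continuous
  have C1 := hc1.continuous
  have C2 := (smooth_deriv hc1).continuous
  have F0 := hφ.continuous
  have F1 := hφ1.continuous
  have F2 := (smooth_deriv hφ1).continuous
  have hd : ∀ {f g : ℝ → ℂ}, ContDiff ℝ ∞ f → ContDiff ℝ ∞ g → ∀ ε : ℝ,
      deriv (fun t => f t + (ε : ℂ) * g t) = fun t => deriv f t + (ε : ℂ) * deriv g t :=
    fun hf hg ε => funext fun t => (((hf.differentiable (by simp)) t).hasDerivAt.fun_add
      (((hg.differentiable (by simp)) t).hasDerivAt.const_mul (ε : ℂ))).deriv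
  set U : Set (ℝ × ℝ) := {p | 0 < (c p.2).im + p.1 * (φ p.2).im} ∩
    {p | deriv c p.2 + (p.1 : ℂ) * deriv φ p.2 ≠ 0} with hUdef
  have hU : IsOpen U := (isOpen_lt (by fun_prop) (by fun_prop)).inter
    (isOpen_ne_fun (by fun_prop) (by fun_prop))
  have hsub : {(0 : ℝ)} ×ˢ Icc a b ⊆ U := by
    rintro ⟨e, t⟩ ⟨he, -⟩
    obtain rfl : e = 0 := he
    exact ⟨by simpa using hy t, by simpa using hv t⟩
  have hw : ∀ p ∈ U, √((deriv c p.2 + (p.1 : ℂ) * deriv φ p.2).re ^ 2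
      + (deriv c p.2 + (p.1 : ℂ) * deriv φ p.2).im ^ 2) ≠ 0 := fun p hp =>
    (Real.sqrt_pos.2 (sq_add_sq_pos hp.2)).ne'
  have hy' : ∀ p ∈ U, (c p.2).im + p.1 * (φ p.2).im ≠ 0 := fun p hp => hp.1.ne'
  have main := hasDerivAt_integral_of_continuousOn (U := U) (x₀ := 0)
    (F := fun ε t => lagr ((c t).im + ε * (φ t).im) (deriv c t + (ε : ℂ) * deriv φ t)
      (deriv (deriv c) t + (ε : ℂ) * deriv (deriv φ) t))
    (F' := fun ε t => lagrVar ((c t).im + ε * (φ t).im) (deriv c t + (ε : ℂ) * deriv φ t)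
      (deriv (deriv c) t + (ε : ℂ) * deriv (deriv φ) t) (φ t).im (deriv φ t) (deriv (deriv φ) t))
    hab hU hsub ?_ ?_ fun p hp => hasDerivAt_lagr hp.1 hp.2
  · simp only [zero_mul, add_zero, Complex.ofReal_zero] at main
    refine main.congr_of_eventuallyEq ?_
    obtain ⟨u, v, hu, -, h0u, hv', huv⟩ :=
      generalized_tube_lemma (isCompact_singleton (x := (0 : ℝ))) isCompact_Icc hU hsub
    filter_upwards [hu.mem_nhds (h0u rfl)] with ε hε
    refine intervalIntegral.integral_congr fun t ht => ?_
    rw [uIcc_of_le hab] at ht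
    have hp : (ε, t) ∈ U := huv ⟨hε, hv' ht⟩
    have e1 := hd hc hφ ε
    have e2 := hd hc1 hφ1 ε
    have him : (c t + (ε : ℂ) * φ t).im = (c t).im + ε * (φ t).im := by simp
    rw [energyDensity_eq (by rw [him]; exact hp.1) (by rw [e1]; exact hp.2), e1, e2, him]
  · unfold lagr curvNum
    refine ContinuousOn.div (by fun_prop) (by fun_prop) fun p hp => ?_
    exact mul_ne_zero (hy' p hp) (pow_ne_zero _ (hw p hp))
  · unfold lagrVar curvNum curvNumVar
    refine ContinuousOn.sub (ContinuousOn.div (by fun_prop) (by fun_prop) fun p hp => ?_)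
      (ContinuousOn.mul (by fun_prop) (ContinuousOn.add
        (ContinuousOn.div (by fun_prop) (by fun_prop) fun p hp => ?_)
        (ContinuousOn.div (by fun_prop) (by fun_prop) fun p hp => ?_)))
    · exact mul_ne_zero (hy' p hp) (pow_ne_zero _ (hw p hp))
    · exact mul_ne_zero (pow_ne_zero _ (hy' p hp)) (pow_ne_zero _ (hw p hp))
    · exact mul_ne_zero (hy' p hp) (pow_ne_zero _ (hw p hp))

/-! ### Unit speed curves and the Euler-Lagrange equation -/

/-- `c` is a curve in the upper half plane of unit hyperbolic speed, with (Euclidean) unit direction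
`ζ` and geodesic curvature `κ`: the Frenet equations of the hyperbolic plane. -/
structure IsUnitSpeed (c ζ : ℝ → ℂ) (κ : ℝ → ℝ) : Prop where
  im_pos : ∀ s, 0 < (c s).im
  norm_eq : ∀ s, (ζ s).re ^ 2 + (ζ s).im ^ 2 = 1
  curve : ∀ s, HasDerivAt c ((c s).im * ζ s) s
  direction : ∀ s, HasDerivAt ζ (Complex.I * ζ s * (κ s - (ζ s).re)) s

theorem _root_.HasDerivAt.complex_im {f : ℝ → ℂ} {f' : ℂ} {t : ℝ} (h : HasDerivAt f f' t) :
    HasDerivAt (fun t => (f t).im) f'.im t :=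
  (Complex.imCLM.hasFDerivAt.comp_hasDerivAt t h :)

theorem _root_.HasDerivAt.complex_re {f : ℝ → ℂ} {f' : ℂ} {t : ℝ} (h : HasDerivAt f f' t) :
    HasDerivAt (fun t => (f t).re) f'.re t :=
  (Complex.reCLM.hasFDerivAt.comp_hasDerivAt t h :)

theorem _root_.ContDiff.complex_im {n : WithTop ℕ∞} {f : ℝ → ℂ} (h : ContDiff ℝ n f) :
    ContDiff ℝ n fun t => (f t).im :=
  Complex.imCLM.contDiff.comp h

theorem _root_.ContDiff.complex_re {n : WithTop ℕ∞} {f : ℝ → ℂ} (h : ContDiff ℝ n f) :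
    ContDiff ℝ n fun t => (f t).re :=
  Complex.reCLM.contDiff.comp h

theorem _root_.ContDiff.hasDerivAt {E : Type*} [NormedAddCommGroup E] [NormedSpace ℝ E]
    {f : ℝ → E} (h : ContDiff ℝ ∞ f) (t : ℝ) : HasDerivAt f (deriv f t) t :=
  (h.differentiable (by simp) t).hasDerivAt

theorem _root_.ContDiff.deriv_infty {E : Type*} [NormedAddCommGroup E] [NormedSpace ℝ E]
    {f : ℝ → E} (h : ContDiff ℝ ∞ f) : ContDiff ℝ ∞ (deriv f) :=
  (contDiff_infty_iff_deriv.1 h).2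

namespace IsUnitSpeed

variable {c ζ : ℝ → ℂ} {κ : ℝ → ℝ}

theorem deriv_curve (h : IsUnitSpeed c ζ κ) : deriv c = fun s => (c s).im * ζ s :=
  funext fun s => (h.curve s).deriv

theorem direction_ne_zero (h : IsUnitSpeed c ζ κ) (s : ℝ) : ζ s ≠ 0 := fun h0 => by
  simpa [h0] using h.norm_eq s

theorem deriv_ne_zero (h : IsUnitSpeed c ζ κ) (s : ℝ) : deriv c s ≠ 0 := by
  rw [h.deriv_curve]
  exact mul_ne_zero (Complex.ofReal_ne_zero.2 (h.im_pos s).ne') (h.direction_ne_zero s)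

theorem hasDerivAt_deriv (h : IsUnitSpeed c ζ κ) (s : ℝ) :
    HasDerivAt (deriv c) (Complex.I * ((c s).im * ζ s) * (κ s - ζ s)) s := by
  rw [h.deriv_curve]
  refine ((h.curve s).complex_im.ofReal_comp.fun_mul (h.direction s)).congr_deriv ?_
  apply Complex.ext <;> simp <;> ring

theorem deriv_deriv (h : IsUnitSpeed c ζ κ) :
    deriv (deriv c) = fun s => Complex.I * ((c s).im * ζ s) * (κ s - ζ s) :=
  funext fun s => (h.hasDerivAt_deriv s).deriv

theorem sqrt_deriv (h : IsUnitSpeed c ζ κ) (s : ℝ) :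
    √((deriv c s).re ^ 2 + (deriv c s).im ^ 2) = (c s).im := by
  rw [h.deriv_curve, Real.sqrt_eq_iff_mul_self_eq_of_pos (h.im_pos s)]
  simp only [Complex.re_ofReal_mul, Complex.im_ofReal_mul]
  linear_combination -(c s).im ^ 2 * h.norm_eq s

theorem hypNorm_deriv (h : IsUnitSpeed c ζ κ) (s : ℝ) : hypNorm (c s) (deriv c s) = 1 := by
  rw [hypNorm_eq (h.im_pos s), h.sqrt_deriv, div_self (h.im_pos s).ne']

theorem curvNum_eq (h : IsUnitSpeed c ζ κ) (s : ℝ) :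
    curvNum (c s).im (deriv c s) (deriv (deriv c) s) = (c s).im ^ 3 * κ s := by
  rw [h.deriv_deriv, h.deriv_curve]
  simp [curvNum]
  linear_combination (c s).im ^ 3 * κ s * h.norm_eq s

theorem curvature_eq (h : IsUnitSpeed c ζ κ) : curvature c = κ := funext fun s => by
  have := (h.im_pos s).ne'
  rw [HypElastica.curvature_eq (h.im_pos s) (h.deriv_ne_zero s), h.curvNum_eq, h.sqrt_deriv]
  field_simp

theorem energyDensity_eq (h : IsUnitSpeed c ζ κ) : energyDensity c = fun s => κ s ^ 2 :=
  funext fun s => by rw [energyDensity, h.curvature_eq, h.hypNorm_deriv, mul_one]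

theorem contDiff_direction (h : IsUnitSpeed c ζ κ) (hc : ContDiff ℝ ∞ c) : ContDiff ℝ ∞ ζ := by
  have : ζ = fun s => deriv c s / ((c s).im : ℂ) := funext fun s => by
    rw [h.deriv_curve, mul_div_cancel_left₀ _ (Complex.ofReal_ne_zero.2 (h.im_pos s).ne')]
  simp only [this, div_eq_mul_inv]
  exact hc.deriv_infty.mul (ContDiff.inv (Complex.ofRealCLM.contDiff.comp hc.complex_im)
    fun s => Complex.ofReal_ne_zero.2 (h.im_pos s).ne')

theorem contDiff_curvature (h : IsUnitSpeed c ζ κ) (hc : ContDiff ℝ ∞ c) : ContDiff ℝ ∞ κ := by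
  have hζ := h.contDiff_direction hc
  have : κ = fun s => (deriv ζ s / ζ s).im + (ζ s).re := funext fun s => by
    rw [(h.direction s).deriv, mul_right_comm, mul_div_cancel_right₀ _ (h.direction_ne_zero s)]
    simp
  simp only [this, div_eq_mul_inv]
  exact (hζ.deriv_infty.mul (hζ.inv h.direction_ne_zero)).complex_im.add hζ.complex_re

/-- The first variation of the energy density of a unit speed curve in the direction of the field
`(g + i f) c'`, with tangential part `g` and normal part `f`, is the Euler-Lagrange expression times
`f` up to the derivative of `2 κ f' - 2 κ' f + κ² g`. -/
theorem lagrVar_eq (h : IsUnitSpeed c ζ κ) (hκ : ContDiff ℝ ∞ κ) {w : ℝ → ℂ}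
    (hw : ContDiff ℝ ∞ w) (s : ℝ) :
    lagrVar (c s).im (deriv c s) (deriv (deriv c) s) (w s * deriv c s).im
        (deriv (fun s => w s * deriv c s) s) (deriv (deriv fun s => w s * deriv c s) s)
      = (2 * deriv (deriv κ) s + κ s ^ 3 - 2 * κ s) * (w s).im
        + deriv (fun s => 2 * κ s * (deriv w s).im - 2 * deriv κ s * (w s).im
          + κ s ^ 2 * (w s).re) s := by
  have hy := (h.im_pos s).ne'
  have e1 : deriv (fun s => w s * deriv c s) = fun s => deriv w s * deriv c s
      + w s * (Complex.I * ((c s).im * ζ s) * (κ s - ζ s)) :=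
    funext fun t => ((hw.hasDerivAt t).fun_mul (h.hasDerivAt_deriv t)).deriv
  have hmul := ((h.curve s).complex_im.ofReal_comp.fun_mul (h.direction s)).const_mul Complex.I
  have hsub := (hκ.hasDerivAt s).ofReal_comp.fun_sub (h.direction s)
  have e2 := (((hw.deriv_infty.hasDerivAt s).fun_mul (h.hasDerivAt_deriv s)).fun_add
    ((hw.hasDerivAt s).fun_mul (hmul.fun_mul hsub))).deriv
  have e3 := (((((hκ.hasDerivAt s).const_mul 2).fun_mul
    (hw.deriv_infty.hasDerivAt s).complex_im).fun_sub
    (((hκ.deriv_infty.hasDerivAt s).const_mul 2).fun_mul (hw.hasDerivAt s).complex_im)).fun_add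
    (((hκ.hasDerivAt s).fun_pow 2).fun_mul (hw.hasDerivAt s).complex_re)).deriv
  rw [e3, e1, e2, lagrVar, h.curvNum_eq, h.sqrt_deriv, h.deriv_deriv, h.deriv_curve]
  have hn := h.norm_eq s
  simp only [curvNumVar, Complex.add_re, Complex.add_im, Complex.sub_re, Complex.sub_im,
    Complex.mul_re, Complex.mul_im, Complex.ofReal_re, Complex.ofReal_im, Complex.I_re,
    Complex.I_im, zero_mul, mul_zero, zero_sub, sub_zero, add_zero, zero_add, one_mul]
  generalize (c s).im = y at *
  generalize (ζ s).re = p at *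
  generalize (ζ s).im = q at *
  generalize κ s = k at *
  generalize deriv κ s = k' at *
  generalize deriv (deriv κ) s = k'' at *
  generalize deriv w s = w' at *
  generalize deriv (deriv w) s = w'' at *
  generalize w s = w at *
  field_simp
  -- What remains is an identity modulo `p² + q² = 1`. Even powers of `q` are eliminated.
  have hq : q ^ 2 = 1 - p ^ 2 := by linarith
  have hq3 : q ^ 3 = q * (1 - p ^ 2) := by rw [← hq]; ring
  have hq4 : q ^ 4 = (1 - p ^ 2) ^ 2 := by rw [← hq]; ring
  ring_nf
  simp only [hq, hq3, hq4]
  ring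

end IsUnitSpeed

/-- The Euler-Lagrange expression of the elastic energy `∫ κ² ds`. -/
noncomputable def eulerLagrange (κ : ℝ → ℝ) (s : ℝ) : ℝ :=
  2 * deriv (deriv κ) s + κ s ^ 3 - 2 * κ s

theorem continuous_eulerLagrange {κ : ℝ → ℝ} (hκ : ContDiff ℝ ∞ κ) :
    Continuous (eulerLagrange κ) := by
  have := hκ.continuous
  have := hκ.deriv_infty.deriv_infty.continuous
  unfold eulerLagrange
  fun_prop

namespace IsUnitSpeed

variable {c ζ : ℝ → ℂ} {κ : ℝ → ℝ}

/-- The first variation formula. Since `c'` never vanishes, every variation field has the form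
`w c'`, so that this covers an arbitrary variation with compact support. -/
theorem hasDerivAt_elasticEnergy (h : IsUnitSpeed c ζ κ) (hc : ContDiff ℝ ∞ c) {w : ℝ → ℂ}
    (hw : ContDiff ℝ ∞ w) {a b : ℝ} (hab : a < b) (hsupp : tsupport w ⊆ Ioo a b) :
    HasDerivAt (fun ε : ℝ => elasticEnergy a b (fun t => c t + (ε : ℂ) * (w t * deriv c t)))
      (∫ t in a..b, eulerLagrange κ t * (w t).im) 0 := by
  have hκ := h.contDiff_curvature hc
  refine (HypElastica.hasDerivAt_elasticEnergy hc (hw.mul hc.deriv_infty) h.im_pos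
    h.deriv_ne_zero hab.le).congr_deriv ?_
  set B : ℝ → ℝ := fun s => 2 * κ s * (deriv w s).im - 2 * deriv κ s * (w s).im
    + κ s ^ 2 * (w s).re with hB
  have hBs : ContDiff ℝ ∞ B :=
    (((contDiff_const.mul hκ).mul hw.deriv_infty.complex_im).sub
      ((contDiff_const.mul hκ.deriv_infty).mul hw.complex_im)).add ((hκ.pow 2).mul hw.complex_re)
  have hB0 : ∀ t, t ∉ Ioo a b → B t = 0 := fun t ht => by
    have h0 : w t = 0 := image_eq_zero_of_notMem_tsupport fun h => ht (hsupp h)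
    have h1 : deriv w t = 0 := image_eq_zero_of_notMem_tsupport fun h =>
      ht (hsupp (tsupport_deriv_subset h))
    simp [hB, h0, h1]
  have hE : Continuous fun t => eulerLagrange κ t * (w t).im :=
    (continuous_eulerLagrange hκ).mul hw.complex_im.continuous
  calc _ = ∫ t in a..b, (eulerLagrange κ t * (w t).im + deriv B t) :=
        intervalIntegral.integral_congr fun t _ => h.lagrVar_eq hκ hw t
    _ = (∫ t in a..b, eulerLagrange κ t * (w t).im) + (B b - B a) := by
        rw [intervalIntegral.integral_add (hE.intervalIntegrable _ _)
          (hBs.deriv_infty.continuous.intervalIntegrable _ _),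
          intervalIntegral.integral_deriv_eq_sub (fun t _ => (hBs.hasDerivAt t).differentiableAt)
          (hBs.deriv_infty.continuous.intervalIntegrable _ _)]
    _ = _ := by rw [hB0 b (by simp), hB0 a (by simp), sub_zero, add_zero]

end IsUnitSpeed

variable {γ : ℝ → UpperHalfPlane} {ζ : ℝ → ℂ} {κ : ℝ → ℝ}

theorem IsUnitSpeed.isElasticCurve (h : IsUnitSpeed (toC γ) ζ κ) (hγ : ContDiff ℝ ∞ (toC γ))
    (hE : ∀ s, eulerLagrange κ s = 0) : IsElasticCurve γ := by
  refine ⟨hγ, h.deriv_ne_zero, fun a b hab φ hφ hsupp => ?_⟩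
  have hw : ContDiff ℝ ∞ fun t => φ t * (deriv (toC γ) t)⁻¹ :=
    hφ.mul (hγ.deriv_infty.inv h.deriv_ne_zero)
  have := h.hasDerivAt_elasticEnergy hγ hw hab ((tsupport_mul_subset_left (f := φ)).trans hsupp)
  simpa [hE, mul_assoc, inv_mul_cancel₀ (h.deriv_ne_zero _)] using this

/-- Normal variations suffice to derive the Euler-Lagrange equation. -/
theorem IsUnitSpeed.eulerLagrange_eq_zero (h : IsUnitSpeed (toC γ) ζ κ) (hγ : IsElasticCurve γ)
    (s : ℝ) : eulerLagrange κ s = 0 := by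
  have hcont := continuous_eulerLagrange (h.contDiff_curvature hγ.smooth)
  have hae : ∀ᵐ t, eulerLagrange κ t = 0 := by
    refine ae_eq_zero_of_integral_contDiff_smul_eq_zero hcont.locallyIntegrable fun f hf hfc => ?_
    obtain ⟨R, hR⟩ := hfc.isCompact.isBounded.subset_ball 0
    have hsub : tsupport f ⊆ Ioo (-(|R| + 1)) (|R| + 1) := fun t ht => by
      have := hR ht
      rw [Metric.mem_ball, dist_zero_right, Real.norm_eq_abs] at this
      exact abs_lt.1 (by linarith [le_abs_self R])
    have hab : -(|R| + 1) < |R| + 1 := by linarith [abs_nonneg R]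
    have hw : ContDiff ℝ ∞ fun t => (f t : ℂ) * Complex.I :=
      (Complex.ofRealCLM.contDiff.comp hf).mul contDiff_const
    have hws : tsupport (fun t => (f t : ℂ) * Complex.I) ⊆ tsupport f :=
      (tsupport_mul_subset_left (f := fun t => (f t : ℂ))).trans
        (closure_mono fun t => by simp)
    have hvar := h.hasDerivAt_elasticEnergy hγ.smooth hw hab (hws.trans hsub)
    have hcrit := hγ.critical _ _ hab _ (hw.mul hγ.smooth.deriv_infty)
      ((tsupport_mul_subset_left (f := fun t => (f t : ℂ) * Complex.I)).trans (hws.trans hsub))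
    have := hvar.unique hcrit
    rw [← intervalIntegral.integral_eq_integral_of_support_subset
      (a := -(|R| + 1)) (b := |R| + 1), ← this]
    · simp [mul_comm]
    · exact (Function.support_smul_subset_left f _).trans
        ((subset_tsupport f).trans (hsub.trans Ioo_subset_Ioc_self))
  have := (hcont.ae_eq_iff_eq (μ := volume) continuous_const).1 hae
  exact congrFun this s

/-- A smooth curve parametrised by hyperbolic arclength satisfies the Frenet equations. -/
theorem IsArclengthParam.isUnitSpeed (h : IsArclengthParam γ) (hγ : ContDiff ℝ ∞ (toC γ)) :
    ∃ ζ κ, IsUnitSpeed (toC γ) ζ κ := by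
  have hy : ∀ s, 0 < (toC γ s).im := fun s => (γ s).im_pos
  have hne : ∀ s, ((toC γ s).im : ℂ) ≠ 0 := fun s => Complex.ofReal_ne_zero.2 (hy s).ne'
  set ζ : ℝ → ℂ := fun s => deriv (toC γ) s * ((toC γ s).im : ℂ)⁻¹ with hζdef
  have hζ : ContDiff ℝ ∞ ζ :=
    hγ.deriv_infty.mul (ContDiff.inv (Complex.ofRealCLM.contDiff.comp hγ.complex_im) hne)
  have hd : ∀ s, deriv (toC γ) s = (toC γ s).im * ζ s := fun s => by
    rw [hζdef, mul_comm, mul_assoc, inv_mul_cancel₀ (hne s), mul_one]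
  have hnorm : ∀ s, (ζ s).re ^ 2 + (ζ s).im ^ 2 = 1 := fun s => by
    have h1 := h s
    rw [hypNorm_eq (hy s), div_eq_one_iff_eq (hy s).ne', Real.sqrt_eq_iff_mul_self_eq_of_pos (hy s),
      hd] at h1
    simp only [Complex.re_ofReal_mul, Complex.im_ofReal_mul] at h1
    refine mul_left_cancel₀ (pow_ne_zero 2 (hy s).ne') ?_
    linear_combination -h1
  refine ⟨ζ, fun s => (ζ s).re * (deriv ζ s).im - (ζ s).im * (deriv ζ s).re + (ζ s).re, hy, hnorm,
    fun s => hd s ▸ hγ.hasDerivAt s, fun s => (hζ.hasDerivAt s).congr_deriv ?_⟩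
  have hperp : (ζ s).re * (deriv ζ s).re + (ζ s).im * (deriv ζ s).im = 0 := by
    have h1 := (((hζ.hasDerivAt s).complex_re.fun_pow 2).fun_add
      ((hζ.hasDerivAt s).complex_im.fun_pow 2)).deriv
    rw [show (fun s => (ζ s).re ^ 2 + (ζ s).im ^ 2) = fun _ => 1 from funext hnorm,
      deriv_const] at h1
    norm_num at h1
    linarith
  have hn := hnorm s
  apply Complex.ext
  · simp
    linear_combination (-(deriv ζ s).re) * hn + (ζ s).re * hperp
  · simp
    linear_combination (-(deriv ζ s).im) * hn + (ζ s).im * hperp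

/-! ### Solutions of the curvature equation with finite energy -/

theorem hasDerivAt_sech (s : ℝ) (τ : ℝ) :
    HasDerivAt (fun s => τ * (2 / Real.cosh s)) (-(τ * (2 * Real.sinh s / Real.cosh s ^ 2))) s := by
  refine (((hasDerivAt_const s (2 : ℝ)).fun_div (Real.hasDerivAt_cosh s)
    (Real.cosh_pos s).ne').const_mul τ).congr_deriv ?_
  have := Real.cosh_pos s
  field_simp
  ring

theorem hasDerivAt_deriv_sech (s : ℝ) {τ : ℝ} (hτ : τ ^ 2 = 1) :
    HasDerivAt (fun s => -(τ * (2 * Real.sinh s / Real.cosh s ^ 2)))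
      (τ * (2 / Real.cosh s) - (τ * (2 / Real.cosh s)) ^ 3 / 2) s := by
  refine (((((Real.hasDerivAt_sinh s).const_mul 2).fun_div ((Real.hasDerivAt_cosh s).fun_pow 2)
    (by have := Real.cosh_pos s; positivity)).const_mul τ).neg).congr_deriv ?_
  have := Real.cosh_pos s
  have h3 : τ ^ 3 = τ := by linear_combination τ * hτ
  rw [mul_pow, h3]
  field_simp
  rw [Real.sinh_sq]
  ring

theorem abs_two_div_cosh_le (s : ℝ) {τ : ℝ} (hτ : τ ^ 2 = 1) : |τ * (2 / Real.cosh s)| ≤ 2 := by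
  have h1 : |τ| = 1 := (pow_eq_one_iff_of_nonneg (abs_nonneg τ) two_ne_zero).1 (by rwa [sq_abs])
  rw [abs_mul, h1, one_mul, abs_of_pos (by have := Real.cosh_pos s; positivity)]
  exact div_le_self (by norm_num) (Real.one_le_cosh s)

/-- Uniqueness for the curvature equation `k'' = k - k³ / 2`. -/
theorem curvatureEquation_unique {k₁ k₂ k₁' k₂' : ℝ → ℝ}
    (h₁ : ∀ s, HasDerivAt k₁ (k₁' s) s) (h₁' : ∀ s, HasDerivAt k₁' (k₁ s - k₁ s ^ 3 / 2) s)
    (h₂ : ∀ s, HasDerivAt k₂ (k₂' s) s) (h₂' : ∀ s, HasDerivAt k₂' (k₂ s - k₂ s ^ 3 / 2) s)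
    {R : ℝ} (b₁ : ∀ s, |k₁ s| ≤ R ∧ |k₁' s| ≤ R) (b₂ : ∀ s, |k₂ s| ≤ R ∧ |k₂' s| ≤ R)
    (h0 : k₁ 0 = k₂ 0) (h0' : k₁' 0 = k₂' 0) : k₁ = k₂ := by
  let v : ℝ × ℝ → ℝ × ℝ := fun u => (u.2, u.1 - u.1 ^ 3 / 2)
  have hv : ContDiff ℝ 1 v := by fun_prop
  obtain ⟨K, hK⟩ := hv.contDiffOn.exists_lipschitzOnWith one_ne_zero
    (convex_closedBall (0 : ℝ × ℝ) R) (isCompact_closedBall 0 R)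
  have mem : ∀ {x y : ℝ}, |x| ≤ R ∧ |y| ≤ R → (x, y) ∈ Metric.closedBall (0 : ℝ × ℝ) R :=
    fun h => by simpa [Prod.norm_def] using h
  have := ODE_solution_unique_univ (t₀ := 0) (v := fun _ => v)
    (s := fun _ => Metric.closedBall 0 R) (fun _ => hK)
    (f := fun s => (k₁ s, k₁' s)) (g := fun s => (k₂ s, k₂' s))
    (fun s => ⟨(h₁ s).prodMk (h₁' s), mem (b₁ s)⟩)
    (fun s => ⟨(h₂ s).prodMk (h₂' s), mem (b₂ s)⟩) (by simp [h0, h0'])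
  exact funext fun s => congrArg Prod.fst (congrFun this s)

theorem hasDerivAt_deriv_of_eulerLagrange {κ : ℝ → ℝ} (hκ : ContDiff ℝ ∞ κ)
    (hE : ∀ s, eulerLagrange κ s = 0) (s : ℝ) :
    HasDerivAt (deriv κ) (κ s - κ s ^ 3 / 2) s := by
  refine (hκ.deriv_infty.hasDerivAt s).congr_deriv ?_
  have := hE s
  unfold eulerLagrange at this
  linarith

/-- Finite energy selects the level zero of the first integral `κ'² + κ⁴ / 4 - κ²`: if its value is
`C`, then `(κ κ')' = C + 2 κ² - 3 κ⁴ / 4`, where `κ κ'` is bounded and the terms in `κ` are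
integrable, so that `C T` stays bounded. -/
theorem deriv_curvature_sq {κ : ℝ → ℝ} (hκ : ContDiff ℝ ∞ κ) (hE : ∀ s, eulerLagrange κ s = 0)
    (hint : Integrable fun s => κ s ^ 2) (s : ℝ) :
    deriv κ s ^ 2 = κ s ^ 2 - κ s ^ 4 / 4 := by
  have h1 := fun s => hκ.hasDerivAt s
  have h2 := hasDerivAt_deriv_of_eulerLagrange hκ hE
  obtain ⟨C, hC⟩ : ∃ C, ∀ s, deriv κ s ^ 2 + κ s ^ 4 / 4 - κ s ^ 2 = C := by
    have hd : ∀ s, HasDerivAt (fun s => deriv κ s ^ 2 + κ s ^ 4 / 4 - κ s ^ 2) 0 s := fun s =>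
      ((((h2 s).fun_pow 2).fun_add (((h1 s).fun_pow 4).div_const 4)).fun_sub
        ((h1 s).fun_pow 2)).congr_deriv (by norm_num; ring)
    exact ⟨_, fun s => is_const_of_deriv_eq_zero (fun s => (hd s).differentiableAt)
      (fun s => (hd s).deriv) s 0⟩
  set M := 8 + 2 * |C| with hM
  have bκ : ∀ s, κ s ^ 2 ≤ M := fun s => by
    have := hC s
    by_contra! hlt
    nlinarith [sq_nonneg (deriv κ s), le_abs_self C, abs_nonneg C]
  have bκ' : ∀ s, deriv κ s ^ 2 ≤ 2 * M := fun s => by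
    nlinarith [hC s, bκ s, le_abs_self C, abs_nonneg C, sq_nonneg (κ s ^ 2)]
  have bprod : ∀ s, |κ s * deriv κ s| ≤ 2 * M := fun s => by
    rw [abs_le]
    constructor <;> nlinarith [bκ s, bκ' s, sq_nonneg (κ s + deriv κ s),
      sq_nonneg (κ s - deriv κ s)]
  set A := 2 + M with hA
  set J := ∫ s, κ s ^ 2 with hJ
  have hcont := hκ.continuous
  have hbound : ∀ T, 0 ≤ T → |C| * T ≤ 4 * M + A * J := fun T hT => by
    have hd : ∀ s, HasDerivAt (fun s => κ s * deriv κ s)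
        (C + (2 * κ s ^ 2 - 3 / 4 * κ s ^ 4)) s := fun s =>
      ((h1 s).fun_mul (h2 s)).congr_deriv (by rw [← hC s]; ring)
    have hi := intervalIntegral.integral_eq_sub_of_hasDerivAt (a := 0) (b := T)
      (fun s _ => hd s) (Continuous.intervalIntegrable (by fun_prop) _ _)
    rw [intervalIntegral.integral_add (by simp) (Continuous.intervalIntegrable (by fun_prop) _ _),
      intervalIntegral.integral_const, smul_eq_mul, sub_zero] at hi
    have hr : ‖∫ s in 0..T, (2 * κ s ^ 2 - 3 / 4 * κ s ^ 4)‖ ≤ ∫ s in 0..T, A * κ s ^ 2 := by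
      refine intervalIntegral.norm_integral_le_of_norm_le hT (.of_forall fun s _ => ?_)
        (Continuous.intervalIntegrable (by fun_prop) _ _)
      rw [Real.norm_eq_abs, abs_le]
      constructor <;> nlinarith [bκ s, sq_nonneg (κ s), sq_nonneg (κ s ^ 2)]
    have hr' : ∫ s in 0..T, A * κ s ^ 2 ≤ A * J := by
      rw [intervalIntegral.integral_const_mul, intervalIntegral.integral_of_le hT]
      exact mul_le_mul_of_nonneg_left (setIntegral_le_integral hint
        (.of_forall fun s => sq_nonneg _)) (by positivity)
    have h0 := bprod 0
    have hT' := bprod T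
    rw [Real.norm_eq_abs] at hr
    rw [← abs_of_nonneg hT, ← abs_mul, abs_le]
    have := abs_le.1 (hr.trans hr')
    have := abs_le.1 h0
    have := abs_le.1 hT'
    constructor <;> nlinarith
  have hC0 : C = 0 := by
    by_contra hne
    have hpos := abs_pos.2 hne
    have hJ0 : 0 ≤ J := integral_nonneg fun s => sq_nonneg _
    have := hbound ((4 * M + A * J + 1) / |C|) (by positivity)
    rw [mul_div_cancel₀ _ hpos.ne'] at this
    linarith
  linarith [hC s]

/-- The curvature functions of elastica of finite energy: the geodesic and the asymptotically
geodesic ones. -/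
theorem curvature_classification {κ : ℝ → ℝ} (hκ : ContDiff ℝ ∞ κ)
    (hE : ∀ s, eulerLagrange κ s = 0) (hint : Integrable fun s => κ s ^ 2) :
    (∀ s, κ s = 0) ∨ ∃ τ s₀ : ℝ, τ ^ 2 = 1 ∧ ∀ s, κ s = τ * (2 / Real.cosh (s + s₀)) := by
  have h1 := fun s => hκ.hasDerivAt s
  have h2 := hasDerivAt_deriv_of_eulerLagrange hκ hE
  have hfi := deriv_curvature_sq hκ hE hint
  have bound : ∀ {k k' : ℝ}, k' ^ 2 = k ^ 2 - k ^ 4 / 4 → |k| ≤ 2 ∧ |k'| ≤ 2 := fun {k k'} h => by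
    have hk : k ^ 2 ≤ 4 := by
      by_contra! hlt
      nlinarith [sq_nonneg k']
    constructor <;> refine abs_le_of_sq_le_sq (by nlinarith [sq_nonneg (k ^ 2)]) (by norm_num)
  by_cases h0 : κ 0 = 0
  · left
    have h0' : deriv κ 0 = 0 := by simpa [h0] using hfi 0
    have := curvatureEquation_unique h1 h2 (k₂ := fun _ => 0) (k₂' := fun _ => 0) (R := 2)
      (fun s => hasDerivAt_const s _) (fun s => by simpa using hasDerivAt_const s (0 : ℝ))
      (fun s => bound (hfi s)) (by simp) h0 h0'
    exact fun s => congrFun this s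
  · right
    obtain ⟨τ, hτ, hτκ⟩ : ∃ τ : ℝ, τ ^ 2 = 1 ∧ 0 < τ * κ 0 := by
      rcases lt_or_gt_of_ne h0 with h | h
      · exact ⟨-1, by norm_num, by linarith⟩
      · exact ⟨1, by norm_num, by linarith⟩
    -- For `κ = 2 τ / cosh (s + s₀)` one has `sinh (s + s₀) = -2 τ κ' / κ²`.
    set s₀ := Real.arsinh (-(2 * τ * deriv κ 0 / κ 0 ^ 2)) with hs₀
    have hsinh : Real.sinh s₀ = -(2 * τ * deriv κ 0 / κ 0 ^ 2) := Real.sinh_arsinh _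
    have hcosh : Real.cosh s₀ = 2 / (τ * κ 0) := by
      refine (sq_eq_sq₀ (Real.cosh_pos _).le (by positivity)).1 ?_
      rw [Real.cosh_sq, hsinh, neg_sq, div_pow, div_pow, mul_pow, mul_pow, mul_pow, hτ, hfi 0]
      field_simp
      ring
    have hτ0 : τ ≠ 0 := fun h => by simp [h] at hτ
    refine ⟨τ, s₀, hτ, fun s => ?_⟩
    have := curvatureEquation_unique h1 h2 (R := 2)
      (fun s => (hasDerivAt_sech (s + s₀) τ).comp_add_const s s₀)
      (fun s => (hasDerivAt_deriv_sech (s + s₀) hτ).comp_add_const s s₀)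
      (fun s => bound (hfi s)) (fun s => bound ?_) ?_ ?_
    · exact congrFun this s
    · have := Real.cosh_pos (s + s₀)
      have h4 : τ ^ 4 = 1 := by linear_combination (τ ^ 2 + 1) * hτ
      rw [neg_sq, mul_pow, mul_pow, mul_pow τ, hτ, h4]
      field_simp
      rw [Real.sinh_sq]
      ring
    · rw [zero_add, hcosh]
      field_simp
      exact hτ.symm
    · rw [zero_add, hcosh, hsinh]
      field_simp
      linear_combination (-deriv κ 0 * (τ ^ 2 + 1)) * hτ

/-! ### Curves with prescribed curvature -/

namespace IsUnitSpeed

variable {c ζ c₁ ζ₁ c₂ ζ₂ : ℝ → ℂ} {κ : ℝ → ℝ}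

theorem norm_direction (h : IsUnitSpeed c ζ κ) (s : ℝ) : ‖ζ s‖ = 1 := by
  rw [Complex.norm_eq_sqrt_sq_add_sq, h.norm_eq, Real.sqrt_one]

/-- A unit speed curve is determined by its (bounded) curvature, its initial point and its initial
direction. -/
theorem unique (h₁ : IsUnitSpeed c₁ ζ₁ κ) (h₂ : IsUnitSpeed c₂ ζ₂ κ) (hκ : ∀ s, |κ s| ≤ 2)
    (hc : c₁ 0 = c₂ 0) (hζ : ζ₁ 0 = ζ₂ 0) : c₁ = c₂ := by
  have hlip : ∀ t, LipschitzOnWith 4 (fun z : ℂ => Complex.I * z * (κ t - z.re))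
      (Metric.closedBall 0 1) := fun t => LipschitzOnWith.of_dist_le_mul fun a ha b hb => by
    rw [mem_closedBall_zero_iff] at ha hb
    rw [dist_eq_norm, dist_eq_norm]
    have e : Complex.I * a * (κ t - a.re) - Complex.I * b * (κ t - b.re)
        = Complex.I * ((a - b) * ((κ t - a.re : ℝ) : ℂ) - b * ((a - b).re : ℂ)) := by
      push_cast [Complex.sub_re]
      ring
    have h1 : |κ t - a.re| ≤ 3 := by
      have := Complex.abs_re_le_norm a
      linarith [abs_sub (κ t) a.re, hκ t]
    calc ‖Complex.I * a * (κ t - a.re) - Complex.I * b * (κ t - b.re)‖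
        ≤ ‖a - b‖ * |κ t - a.re| + ‖b‖ * |(a - b).re| := by
          rw [e, norm_mul, Complex.norm_I, one_mul]
          refine (norm_sub_le _ _).trans_eq ?_
          simp only [norm_mul, Complex.norm_real, Real.norm_eq_abs]
      _ ≤ ‖a - b‖ * 3 + 1 * ‖a - b‖ := by
          gcongr
          exact Complex.abs_re_le_norm _
      _ = (4 : NNReal) * ‖a - b‖ := by push_cast; ring
  have hζeq : ζ₁ = ζ₂ := ODE_solution_unique_univ (t₀ := 0) hlip
    (fun s => ⟨h₁.direction s, by simp [h₁.norm_direction s]⟩)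
    (fun s => ⟨h₂.direction s, by simp [h₂.norm_direction s]⟩) hζ
  subst hζeq
  have him : ∀ s, (c₁ s).im = (c₂ s).im := fun s => by
    have hd : ∀ s, HasDerivAt (fun s => (c₁ s).im / (c₂ s).im) 0 s := fun s =>
      ((h₁.curve s).complex_im.fun_div (h₂.curve s).complex_im (h₂.im_pos s).ne').congr_deriv (by
        simp only [Complex.im_ofReal_mul]
        ring)
    have := is_const_of_deriv_eq_zero (fun s => (hd s).differentiableAt) (fun s => (hd s).deriv) s 0
    rwa [hc, div_self (h₂.im_pos 0).ne', div_eq_one_iff_eq (h₂.im_pos s).ne'] at this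
  have hd : ∀ s, HasDerivAt (fun s => c₁ s - c₂ s) 0 s := fun s =>
    ((h₁.curve s).fun_sub (h₂.curve s)).congr_deriv (by rw [him]; ring)
  refine funext fun s => sub_eq_zero.1 ?_
  have := is_const_of_deriv_eq_zero (fun s => (hd s).differentiableAt) (fun s => (hd s).deriv) s 0
  rw [this, hc, sub_self]

/-- Orientation preserving isometries, that is real Möbius transformations of positive determinant,
preserve the Frenet equations with the same curvature. -/
theorem moebius (h : IsUnitSpeed c ζ κ) {p q r t : ℝ} (hdet : 0 < p * t - q * r) :
    (∀ s, (r : ℂ) * c s + t ≠ 0) ∧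
    IsUnitSpeed (fun s => ((p : ℂ) * c s + q) / (r * c s + t))
      (fun s => ζ s * (r * (starRingEnd ℂ) (c s) + t) / (r * c s + t)) κ := by
  have hne : ∀ s, (r : ℂ) * c s + t ≠ 0 := fun s h0 => by
    have h1 := congrArg Complex.im h0
    have h2 := congrArg Complex.re h0
    simp at h1 h2
    rcases h1 with h1 | h1
    · simp [h1] at h2
      simp [h1, h2] at hdet
    · exact (h.im_pos s).ne' h1
  have hconj : ∀ s, (starRingEnd ℂ) ((r : ℂ) * c s + t) = r * (starRingEnd ℂ) (c s) + t := by simp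
  have hne' : ∀ s, (r : ℂ) * (starRingEnd ℂ) (c s) + t ≠ 0 := fun s => by
    rw [← hconj]
    exact (map_ne_zero _).2 (hne s)
  have hnsq : ∀ s, ((Complex.normSq (r * c s + t) : ℝ) : ℂ)
      = (r * (starRingEnd ℂ) (c s) + t) * (r * c s + t) := fun s => by
    rw [← hconj, Complex.normSq_eq_conj_mul_self]
  have him : ∀ s, (((p : ℂ) * c s + q) / (r * c s + t)).im
      = (p * t - q * r) * (c s).im / Complex.normSq (r * c s + t) := fun s => by
    rw [Complex.div_im]
    simp only [Complex.add_re, Complex.add_im, Complex.re_ofReal_mul, Complex.im_ofReal_mul,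
      Complex.ofReal_re, Complex.ofReal_im]
    ring
  have hconjd : ∀ s, HasDerivAt (fun s => (starRingEnd ℂ) (c s))
      ((c s).im * (starRingEnd ℂ) (ζ s)) s := fun s =>
    (h.curve s).star.congr_deriv (by simp)
  refine ⟨hne, fun s => ?_, fun s => ?_, fun s => ?_, fun s => ?_⟩
  · rw [him]
    exact div_pos (mul_pos hdet (h.im_pos s)) (Complex.normSq_pos.2 (hne s))
  · have : Complex.normSq (ζ s * (r * (starRingEnd ℂ) (c s) + t) / (r * c s + t)) = 1 := by
      rw [Complex.normSq_div, Complex.normSq_mul, ← hconj, Complex.normSq_conj,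
        mul_div_cancel_right₀ _ (Complex.normSq_pos.2 (hne s)).ne', Complex.normSq_apply,
        ← h.norm_eq s]
      ring
    rw [Complex.normSq_apply] at this
    rw [← this]
    ring
  · refine ((((h.curve s).const_mul (p : ℂ)).add_const (q : ℂ)).fun_div
      (((h.curve s).const_mul (r : ℂ)).add_const (t : ℂ)) (hne s)).congr_deriv ?_
    rw [him]
    push_cast
    rw [hnsq]
    have := hne s
    have := hne' s
    field_simp
    ring
  · have hd := ((h.direction s).fun_mul (((hconjd s).const_mul (r : ℂ)).add_const (t : ℂ))).fun_div
      (((h.curve s).const_mul (r : ℂ)).add_const (t : ℂ)) (hne s)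
    refine hd.congr_deriv ?_
    have h1 := hne s
    have h2 := hne' s
    -- Everything is expressed through `c`, `ζ` and their conjugates, with `ζ ζ̄ = 1`.
    have hζζ : ζ s * (starRingEnd ℂ) (ζ s) = 1 := by
      rw [Complex.mul_conj, Complex.normSq_apply]
      exact_mod_cast (by linear_combination h.norm_eq s)
    have ere : ∀ z : ℂ, (z.re : ℂ) = (z + (starRingEnd ℂ) z) / 2 := Complex.re_eq_add_conj
    have eim : ((c s).im : ℂ) = (c s - (starRingEnd ℂ) (c s)) / (2 * Complex.I) :=
      Complex.im_eq_sub_conj _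
    have hζ0 := h.direction_ne_zero s
    have hζ' : (starRingEnd ℂ) (ζ s) = (ζ s)⁻¹ := eq_inv_of_mul_eq_one_right hζζ
    rw [ere, ere, eim, map_div₀, map_mul, map_add, map_mul, map_add, map_mul, Complex.conj_conj,
      Complex.conj_ofReal, Complex.conj_ofReal, hζ']
    generalize (starRingEnd ℂ) (c s) = w at *
    generalize c s = z at *
    generalize ζ s = u at *
    field_simp
    rw [Complex.I_sq]
    ring

end IsUnitSpeed

/-- The catenary with curvature `2 τ / cosh (s + s₀)`, for a sign `τ`: the asymptotically geodesic
elastica with both ends at infinity. -/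
noncomputable def catenary (τ s₀ s : ℝ) : ℂ :=
  ((τ * s : ℝ) : ℂ) + Real.cosh (s + s₀) * Complex.I

theorem catenary_im (τ s₀ s : ℝ) : (catenary τ s₀ s).im = Real.cosh (s + s₀) := by
  simp only [catenary, Complex.add_im, Complex.ofReal_im, Complex.mul_im, Complex.ofReal_re,
    Complex.I_re, Complex.I_im, zero_add, mul_one, mul_zero, add_zero]

theorem catenary_ne_zero (τ s₀ s : ℝ) : catenary τ s₀ s ≠ 0 := fun h0 => by
  have := congrArg Complex.im h0
  rw [catenary_im] at this
  exact (Real.cosh_pos _).ne' this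

theorem isUnitSpeed_catenary {τ : ℝ} (hτ : τ ^ 2 = 1) (s₀ : ℝ) :
    IsUnitSpeed (catenary τ s₀)
      (fun s => ((τ / Real.cosh (s + s₀) : ℝ) : ℂ)
        + (Real.sinh (s + s₀) / Real.cosh (s + s₀) : ℝ) * Complex.I)
      (fun s => τ * (2 / Real.cosh (s + s₀))) := by
  have hC : ∀ s, 0 < Real.cosh (s + s₀) := fun s => Real.cosh_pos _
  have hc : ∀ s, HasDerivAt (fun s => Real.cosh (s + s₀)) (Real.sinh (s + s₀)) s := fun s =>
    (Real.hasDerivAt_cosh _).comp_add_const s s₀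
  have hs : ∀ s, HasDerivAt (fun s => Real.sinh (s + s₀)) (Real.cosh (s + s₀)) s := fun s =>
    (Real.hasDerivAt_sinh _).comp_add_const s s₀
  refine ⟨fun s => ?_, fun s => ?_, fun s => ?_, fun s => ?_⟩
  · rw [catenary_im]
    exact hC s
  · simp only [Complex.add_re, Complex.add_im, Complex.ofReal_re, Complex.ofReal_im,
      Complex.mul_re, Complex.mul_im, Complex.I_re, Complex.I_im]
    have := hC s
    field_simp
    ring_nf
    rw [hτ, Real.cosh_sq]
    ring
  · refine (((hasDerivAt_id s).const_mul τ).ofReal_comp.fun_add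
      ((hc s).ofReal_comp.mul_const Complex.I)).congr_deriv ?_
    have := (hC s).ne'
    rw [catenary_im]
    apply Complex.ext
    · simp only [Complex.add_re, Complex.add_im, Complex.ofReal_re, Complex.ofReal_im,
        Complex.mul_re, Complex.mul_im, Complex.I_re, Complex.I_im]
      field_simp
      ring
    · simp only [Complex.add_re, Complex.add_im, Complex.ofReal_re, Complex.ofReal_im,
        Complex.mul_re, Complex.mul_im, Complex.I_re, Complex.I_im]
      field_simp
      ring
  · refine (((hasDerivAt_const s τ).fun_div (hc s) (hC s).ne').ofReal_comp.fun_add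
      (((hs s).fun_div (hc s) (hC s).ne').ofReal_comp.mul_const Complex.I)).congr_deriv ?_
    have := (hC s).ne'
    have e := Real.cosh_sq (s + s₀)
    apply Complex.ext
    · simp only [Complex.add_re, Complex.add_im, Complex.sub_re, Complex.sub_im, Complex.ofReal_re,
        Complex.ofReal_im, Complex.mul_re, Complex.mul_im, Complex.I_re, Complex.I_im]
      field_simp
      ring
    · simp only [Complex.add_re, Complex.add_im, Complex.sub_re, Complex.sub_im, Complex.ofReal_re,
        Complex.ofReal_im, Complex.mul_re, Complex.mul_im, Complex.I_re, Complex.I_im]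
      field_simp
      ring_nf
      rw [hτ, e]
      ring

/-! ### Explicit elastica -/

theorem tendsto_cosh_add_atTop (s₀ : ℝ) : Tendsto (fun s => Real.cosh (s + s₀)) atTop atTop := by
  refine tendsto_atTop_mono (fun s => ?_) (tendsto_atTop_add_const_right _ s₀ tendsto_id)
  rcases le_or_gt 0 (s + s₀) with h | h
  · exact (Real.self_le_sinh_iff.2 h).trans (Real.sinh_lt_cosh _).le
  · exact h.le.trans (Real.cosh_pos _).le

theorem integrable_sech_sq (s₀ : ℝ) {τ : ℝ} (hτ : τ ^ 2 = 1) :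
    Integrable fun s => (τ * (2 / Real.cosh (s + s₀))) ^ 2 := by
  have h : Integrable fun s : ℝ => (τ * (2 / Real.cosh s)) ^ 2 := by
    refine (integrable_inv_one_add_sq.const_mul 4).mono' ?_ (.of_forall fun s => ?_)
    · exact (continuous_const.mul (continuous_const.div Real.continuous_cosh
        fun s => (Real.cosh_pos s).ne')).pow 2 |>.aestronglyMeasurable
    · have hs : s ^ 2 ≤ Real.sinh s ^ 2 := by
        rw [sq_le_sq]
        rcases le_total 0 s with h | h
        · rw [abs_of_nonneg h, abs_of_nonneg (Real.sinh_nonneg_iff.2 h)]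
          exact Real.self_le_sinh_iff.2 h
        · rw [abs_of_nonpos h, abs_of_nonpos (Real.sinh_nonpos_iff.2 h)]
          exact neg_le_neg (Real.sinh_le_self_iff.2 h)
      rw [Real.norm_eq_abs, abs_of_nonneg (sq_nonneg _), mul_pow, hτ, one_mul, div_pow,
        Real.cosh_sq, ← div_eq_mul_inv, add_comm (Real.sinh s ^ 2)]
      norm_num
      gcongr
  exact h.comp_add_right s₀

theorem contDiff_catenary (τ s₀ : ℝ) : ContDiff ℝ ∞ (catenary τ s₀) := by
  have h1 : ContDiff ℝ ∞ fun s : ℝ => τ * s := by fun_prop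
  have h2 : ContDiff ℝ ∞ fun s : ℝ => Real.cosh (s + s₀) := by fun_prop
  exact (Complex.ofRealCLM.contDiff.comp h1).add
    ((Complex.ofRealCLM.contDiff.comp h2).mul contDiff_const)

theorem tendsto_inv_catenary (τ s₀ : ℝ) :
    Tendsto (fun s => (catenary τ s₀ s)⁻¹) atTop (𝓝 0) := by
  refine tendsto_inv₀_cobounded.comp (tendsto_norm_atTop_iff_cobounded.1 ?_)
  refine tendsto_atTop_mono (fun s => ?_) (tendsto_cosh_add_atTop s₀)
  rw [← catenary_im τ]
  exact (le_abs_self _).trans (Complex.abs_im_le_norm _)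

/-- The parameters `(m, n)` for which the Möbius transformation in `asympCurve` moves the start
of the catenary to `(0, α)` and its direction there to `(σ, 0)`, for signs `σ` and `τ`. Up to
normalisation and sign, `m` and `n` are the cosine and the sine of half of the angle of rotation. -/
structure IsRotationParam (σ τ s₀ m n : ℝ) : Prop where
  sign : m ^ 2 - n ^ 2 = σ * τ
  sinh : 2 * m * n = Real.sinh s₀
  cosh : m ^ 2 + n ^ 2 = Real.cosh s₀

/-- By the half-angle formulas, `(cosh (s₀ / 2), sinh (s₀ / 2))` or the swapped pair works,
depending on the sign `σ τ`. -/
theorem exists_isRotationParam {σ τ : ℝ} (hσ : σ ^ 2 = 1) (hτ : τ ^ 2 = 1) (s₀ : ℝ) :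
    ∃ m n, IsRotationParam σ τ s₀ m n := by
  have h1 := Real.cosh_sq (s₀ / 2)
  have h2 := Real.sinh_two_mul (s₀ / 2)
  have h3 := Real.cosh_two_mul (s₀ / 2)
  rw [mul_div_cancel₀ _ two_ne_zero] at h2 h3
  have h4 : (σ * τ - 1) * (σ * τ + 1) = 0 := by linear_combination τ ^ 2 * hσ + hτ
  rcases mul_eq_zero.1 h4 with h | h
  · exact ⟨_, _, by linarith, by rw [h2]; ring, h3.symm⟩
  · exact ⟨Real.sinh (s₀ / 2), Real.cosh (s₀ / 2), by linarith, by rw [h2], by rw [h3]; ring⟩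

/-- The image of a catenary under the Möbius transformation with matrix
`(α m, -α σ n C; σ n, m C)`, where `C = cosh s₀`. -/
noncomputable def asympCurve (α σ τ s₀ m n s : ℝ) : ℂ :=
  (((α * m : ℝ) : ℂ) * catenary τ s₀ s + ((-(α * σ * n * Real.cosh s₀) : ℝ) : ℂ))
    / (((σ * n : ℝ) : ℂ) * catenary τ s₀ s + ((m * Real.cosh s₀ : ℝ) : ℂ))

section AsympCurve

variable {α σ τ s₀ m n : ℝ}

theorem IsRotationParam.det_pos (h : IsRotationParam σ τ s₀ m n) (hα : 0 < α) (hσ : σ ^ 2 = 1) :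
    0 < α * m * (m * Real.cosh s₀) - -(α * σ * n * Real.cosh s₀) * (σ * n) := by
  have h1 := Real.cosh_pos s₀
  have : α * m * (m * Real.cosh s₀) - -(α * σ * n * Real.cosh s₀) * (σ * n)
      = α * Real.cosh s₀ ^ 2 := by
    rw [sq (Real.cosh s₀)]
    nth_rewrite 4 [← h.cosh]
    linear_combination α * Real.cosh s₀ * n ^ 2 * hσ
  rw [this]
  positivity

theorem IsRotationParam.denom_ne_zero (h : IsRotationParam σ τ s₀ m n) (hα : 0 < α)
    (hσ : σ ^ 2 = 1) (hτ : τ ^ 2 = 1) (s : ℝ) :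
    ((σ * n : ℝ) : ℂ) * catenary τ s₀ s + ((m * Real.cosh s₀ : ℝ) : ℂ) ≠ 0 :=
  ((isUnitSpeed_catenary hτ s₀).moebius (h.det_pos hα hσ)).1 s

theorem isUnitSpeed_asympCurve (h : IsRotationParam σ τ s₀ m n) (hα : 0 < α) (hσ : σ ^ 2 = 1)
    (hτ : τ ^ 2 = 1) :
    ∃ ζ, IsUnitSpeed (asympCurve α σ τ s₀ m n) ζ (fun s => τ * (2 / Real.cosh (s + s₀))) ∧
      ζ 0 = σ := by
  refine ⟨_, ((isUnitSpeed_catenary hτ s₀).moebius (h.det_pos hα hσ)).2, ?_⟩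
  rw [div_eq_iff (h.denom_ne_zero hα hσ hτ 0), catenary]
  have hC := (Real.cosh_pos s₀).ne'
  have h1 := h.sign
  have h2 := h.sinh
  have h3 := h.cosh
  simp only [zero_add]
  generalize Real.cosh s₀ = C at *
  generalize Real.sinh s₀ = S at *
  apply Complex.ext
  · simp
    field_simp
    rw [← h2, ← h3]
    linear_combination (-σ * m) * h1 - τ * m * hσ
  · simp
    field_simp
    rw [← h2, ← h3]
    linear_combination n * h1 - n * (m ^ 2 + n ^ 2) * hσ

theorem asympCurve_zero (h : IsRotationParam σ τ s₀ m n) (hα : 0 < α) (hσ : σ ^ 2 = 1)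
    (hτ : τ ^ 2 = 1) : asympCurve α σ τ s₀ m n 0 = ⟨0, α⟩ := by
  rw [asympCurve, div_eq_iff (h.denom_ne_zero hα hσ hτ 0), catenary]
  apply Complex.ext
  · simp
    ring
  · simp
    ring

theorem contDiff_asympCurve (h : IsRotationParam σ τ s₀ m n) (hα : 0 < α) (hσ : σ ^ 2 = 1)
    (hτ : τ ^ 2 = 1) : ContDiff ℝ ∞ (asympCurve α σ τ s₀ m n) := by
  have hc := contDiff_catenary τ s₀
  exact ((contDiff_const.mul hc).add contDiff_const).mul
    (((contDiff_const.mul hc).add contDiff_const).inv (h.denom_ne_zero hα hσ hτ))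

theorem tendsto_asympCurve (hσ : σ ^ 2 = 1) (hn : n ≠ 0) :
    Tendsto (asympCurve α σ τ s₀ m n) atTop (𝓝 ((α * m / (σ * n) : ℝ) : ℂ)) := by
  have hσ0 : σ ≠ 0 := fun h => by simp [h] at hσ
  have hi := tendsto_inv_catenary τ s₀
  have h1 := ((hi.const_mul ((-(α * σ * n * Real.cosh s₀) : ℝ) : ℂ)).const_add
    ((α * m : ℝ) : ℂ)).div ((hi.const_mul ((m * Real.cosh s₀ : ℝ) : ℂ)).const_add
    ((σ * n : ℝ) : ℂ)) (by simp [hσ0, hn])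
  rw [mul_zero, mul_zero, add_zero, add_zero, ← Complex.ofReal_div] at h1
  refine h1.congr fun s => ?_
  have hne := catenary_ne_zero τ s₀ s
  simp only [Pi.div_apply, asympCurve]
  rw [← mul_div_mul_right _ _ hne, add_mul, add_mul, inv_mul_cancel_right₀ hne,
    inv_mul_cancel_right₀ hne]

/-- The endpoint of an asymptotically geodesic elastica. If it is finite then `n ≠ 0`, since the
curve is unbounded otherwise; the equation is stated without division. -/
theorem endpoint_eq (h : IsRotationParam σ τ s₀ m n) (hα : 0 < α) (hσ : σ ^ 2 = 1)
    {x : ℝ} (hx : Tendsto (asympCurve α σ τ s₀ m n) atTop (𝓝 (x : ℂ))) :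
    x * (σ * n) = α * m := by
  by_cases hn : n = 0
  · -- Then the transformation is a similarity and the curve divided by the catenary is constant.
    have hi := tendsto_inv_catenary τ s₀
    have hC := (Real.cosh_pos s₀).ne'
    have hm : m ≠ 0 := fun h0 => by
      have := h.cosh
      simp [h0, hn] at this
      exact hC this.symm
    have h1 := hx.mul hi
    have h2 : ∀ s, asympCurve α σ τ s₀ m n s * (catenary τ s₀ s)⁻¹
        = ((α / Real.cosh s₀ : ℝ) : ℂ) := fun s => by
      have hne := catenary_ne_zero τ s₀ s
      rw [asympCurve, hn]
      generalize Real.cosh s₀ = C at *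
      have hC' : (C : ℂ) ≠ 0 := by exact_mod_cast hC
      have hm' : (m : ℂ) ≠ 0 := by exact_mod_cast hm
      push_cast
      simp only [mul_zero, zero_mul, neg_zero, add_zero, zero_add]
      field_simp
    simp only [h2, mul_zero] at h1
    have := tendsto_nhds_unique h1 tendsto_const_nhds
    exact absurd (Complex.ofReal_eq_zero.1 this.symm) (div_pos hα (Real.cosh_pos s₀)).ne'
  · have hσ0 : σ ≠ 0 := fun h => by simp [h] at hσ
    have := tendsto_nhds_unique hx (tendsto_asympCurve hσ hn)
    rw [Complex.ofReal_inj] at this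
    rw [this, div_mul_cancel₀ _ (mul_ne_zero hσ0 hn)]

end AsympCurve

/-- The geodesic through `(0, α)` with endpoints `(±α, 0)`, run through in the direction of the sign
`σ`. -/
noncomputable def geodesic (α σ s : ℝ) : ℂ :=
  ((σ * α * (Real.sinh s / Real.cosh s) : ℝ) : ℂ) + (α / Real.cosh s : ℝ) * Complex.I

theorem isUnitSpeed_geodesic {α σ : ℝ} (hα : 0 < α) (hσ : σ ^ 2 = 1) :
    IsUnitSpeed (geodesic α σ)
      (fun s => ((σ / Real.cosh s : ℝ) : ℂ) + (-(Real.sinh s / Real.cosh s) : ℝ) * Complex.I)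
      (fun _ => 0) := by
  have hC : ∀ s, 0 < Real.cosh s := Real.cosh_pos
  have hc := Real.hasDerivAt_cosh
  have hs := Real.hasDerivAt_sinh
  have him : ∀ s, (geodesic α σ s).im = α / Real.cosh s := fun s => by
    simp only [geodesic, Complex.add_im, Complex.ofReal_im, Complex.mul_im, Complex.ofReal_re,
      Complex.I_re, Complex.I_im, zero_add, mul_one, mul_zero, add_zero]
  refine ⟨fun s => ?_, fun s => ?_, fun s => ?_, fun s => ?_⟩
  · rw [him]
    exact div_pos hα (hC s)
  · simp only [Complex.add_re, Complex.add_im, Complex.ofReal_re, Complex.ofReal_im,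
      Complex.mul_re, Complex.mul_im, Complex.I_re, Complex.I_im]
    have := hC s
    field_simp
    ring_nf
    rw [hσ, Real.cosh_sq]
    ring
  · refine ((((hs s).fun_div (hc s) (hC s).ne').const_mul (σ * α)).ofReal_comp.fun_add
      (((hasDerivAt_const s α).fun_div (hc s) (hC s).ne').ofReal_comp.mul_const
        Complex.I)).congr_deriv ?_
    have := (hC s).ne'
    have e := Real.cosh_sq s
    rw [him]
    apply Complex.ext
    · simp only [Complex.add_re, Complex.add_im, Complex.ofReal_re, Complex.ofReal_im,
        Complex.mul_re, Complex.mul_im, Complex.I_re, Complex.I_im]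
      field_simp
      rw [e]
      ring
    · simp only [Complex.add_re, Complex.add_im, Complex.ofReal_re, Complex.ofReal_im,
        Complex.mul_re, Complex.mul_im, Complex.I_re, Complex.I_im]
      field_simp
      ring
  · refine (((hasDerivAt_const s σ).fun_div (hc s) (hC s).ne').ofReal_comp.fun_add
      (((hs s).fun_div (hc s) (hC s).ne').neg.ofReal_comp.mul_const Complex.I)).congr_deriv ?_
    have := (hC s).ne'
    have e := Real.cosh_sq s
    apply Complex.ext
    · simp only [Complex.add_re, Complex.add_im, Complex.sub_re, Complex.sub_im, Complex.ofReal_re,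
        Complex.ofReal_im, Complex.mul_re, Complex.mul_im, Complex.I_re, Complex.I_im]
      field_simp
      ring
    · simp only [Complex.add_re, Complex.add_im, Complex.sub_re, Complex.sub_im, Complex.ofReal_re,
        Complex.ofReal_im, Complex.mul_re, Complex.mul_im, Complex.I_re, Complex.I_im]
      field_simp
      ring_nf
      rw [hσ, e]
      ring

theorem contDiff_geodesic (α σ : ℝ) : ContDiff ℝ ∞ (geodesic α σ) := by
  have hne : ∀ s, Real.cosh s ≠ 0 := fun s => (Real.cosh_pos s).ne'
  have h1 : ContDiff ℝ ∞ fun s : ℝ => σ * α * (Real.sinh s / Real.cosh s) :=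
    contDiff_const.mul (Real.contDiff_sinh.div Real.contDiff_cosh hne)
  have h2 : ContDiff ℝ ∞ fun s : ℝ => α / Real.cosh s :=
    contDiff_const.div Real.contDiff_cosh hne
  exact (Complex.ofRealCLM.contDiff.comp h1).add
    ((Complex.ofRealCLM.contDiff.comp h2).mul contDiff_const)

theorem tendsto_geodesic (α σ : ℝ) :
    Tendsto (geodesic α σ) atTop (𝓝 ((σ * α : ℝ) : ℂ)) := by
  have hcosh : Tendsto Real.cosh atTop atTop := by simpa using tendsto_cosh_add_atTop 0
  have hinv : Tendsto (fun s => (Real.cosh s)⁻¹) atTop (𝓝 0) := tendsto_inv_atTop_zero.comp hcosh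
  have h1 : Tendsto (fun s => Real.sinh s / Real.cosh s) atTop (𝓝 1) := by
    -- `tanh s = 1 - exp (-s) / cosh s`
    have := (tendsto_const_nhds (x := (1 : ℝ))).sub (Real.tendsto_exp_neg_atTop_nhds_zero.mul hinv)
    rw [mul_zero, sub_zero] at this
    refine this.congr fun s => ?_
    have := Real.cosh_pos s
    rw [← Real.cosh_sub_sinh]
    field_simp
    ring
  have h2 : Tendsto (fun s => α / Real.cosh s) atTop (𝓝 0) := by
    simpa [div_eq_mul_inv] using hinv.const_mul α
  have h3 := ((Complex.continuous_ofReal.tendsto _).comp (h1.const_mul (σ * α))).add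
    (((Complex.continuous_ofReal.tendsto _).comp h2).mul_const Complex.I)
  rw [mul_one, Complex.ofReal_zero, zero_mul, add_zero] at h3
  exact h3

/-! ### Elastica of finite energy through `(0, α)` with horizontal velocity -/

theorem eulerLagrange_sech {τ : ℝ} (hτ : τ ^ 2 = 1) (s₀ s : ℝ) :
    eulerLagrange (fun s => τ * (2 / Real.cosh (s + s₀))) s = 0 := by
  have h1 : deriv (fun s => τ * (2 / Real.cosh (s + s₀))) = fun s =>
      -(τ * (2 * Real.sinh (s + s₀) / Real.cosh (s + s₀) ^ 2)) :=
    funext fun s => ((hasDerivAt_sech (s + s₀) τ).comp_add_const s s₀).deriv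
  rw [eulerLagrange, h1, ((hasDerivAt_deriv_sech (s + s₀) hτ).comp_add_const s s₀).deriv]
  ring

theorem isFiniteElasticaTo_of_isUnitSpeed {α σ x : ℝ} {γ : ℝ → UpperHalfPlane} {ζ : ℝ → ℂ}
    {κ : ℝ → ℝ} (h : IsUnitSpeed (toC γ) ζ κ) (hγ : ContDiff ℝ ∞ (toC γ))
    (hE : ∀ s, eulerLagrange κ s = 0) (hint : Integrable fun s => κ s ^ 2)
    (h0 : toC γ 0 = ⟨0, α⟩) (hζ : ζ 0 = σ) (hx : Tendsto (toC γ) atTop (𝓝 (x : ℂ))) :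
    IsFiniteElasticaTo α (σ * α) x γ where
  elastic := h.isElasticCurve hγ hE
  arclength := h.hypNorm_deriv
  finiteEnergy := by rwa [HasFiniteEnergy, h.energyDensity_eq]
  start := h0
  velocity := by
    rw [h.deriv_curve]
    apply Complex.ext <;> simp [hζ, h0, mul_comm]
  limit := hx

/-- An elastica of finite energy with horizontal initial velocity is a geodesic, or its curvature is
`2 τ / cosh (s + s₀)`, where `τ` and `s₀` are tied to the endpoint `x = σ ρ α` through the
parameters `m = ρ n` and `n` of the rotation. -/
theorem IsFiniteElasticaTo.classification {α σ x : ℝ} (hα : 0 < α) (hσ : σ ^ 2 = 1)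
    {η : ℝ → UpperHalfPlane} (hη : IsFiniteElasticaTo α (σ * α) x η) :
    ∃ ζ κ, IsUnitSpeed (toC η) ζ κ ∧ ζ 0 = σ ∧
      ((κ = (fun _ => 0) ∧ x = σ * α) ∨
        ∃ τ s₀ n : ℝ, τ ^ 2 = 1 ∧ κ = (fun s => τ * (2 / Real.cosh (s + s₀))) ∧
          n ^ 2 * ((σ * x / α) ^ 2 - 1) = σ * τ ∧ 2 * (σ * x / α) * n ^ 2 = Real.sinh s₀) := by
  obtain ⟨ζ, κ, h⟩ := hη.arclength.isUnitSpeed hη.elastic.smooth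
  have hint : Integrable fun s => κ s ^ 2 := by
    have := hη.finiteEnergy
    rwa [HasFiniteEnergy, h.energyDensity_eq] at this
  have hζ : ζ 0 = σ := by
    have := (congrFun h.deriv_curve 0).symm.trans hη.velocity
    rw [hη.start] at this
    have hα' : (α : ℂ) ≠ 0 := by exact_mod_cast hα.ne'
    refine mul_left_cancel₀ hα' (this.trans ?_)
    apply Complex.ext <;> simp [mul_comm]
  have hlim : Tendsto (toC η) atTop (𝓝 (x : ℂ)) := hη.limit
  refine ⟨ζ, κ, h, hζ, ?_⟩
  rcases curvature_classification (h.contDiff_curvature hη.elastic.smooth)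
    (h.eulerLagrange_eq_zero hη.elastic) hint with h0 | ⟨τ, s₀, hτ, hκ⟩
  · obtain rfl : κ = fun _ => 0 := funext h0
    have heq : toC η = geodesic α σ := h.unique (isUnitSpeed_geodesic hα hσ) (by simp)
      (by rw [hη.start]; apply Complex.ext <;> simp [geodesic]) (by simp [hζ])
    rw [heq] at hlim
    exact .inl ⟨rfl, Complex.ofReal_inj.1 (tendsto_nhds_unique hlim (tendsto_geodesic α σ))⟩
  · obtain rfl := funext hκ
    obtain ⟨m, n, hmn⟩ := exists_isRotationParam hσ hτ s₀
    obtain ⟨ζ', h', hζ'⟩ := isUnitSpeed_asympCurve hmn hα hσ hτ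
    have heq := h.unique h' (fun s => abs_two_div_cosh_le _ hτ)
      (by rw [hη.start, asympCurve_zero hmn hα hσ hτ]) (hζ.trans hζ'.symm)
    rw [heq] at hlim
    have hend := endpoint_eq hmn hα hσ hlim
    have hm : m = σ * x / α * n := by
      field_simp
      linarith
    refine .inr ⟨τ, s₀, n, hτ, rfl, ?_, ?_⟩
    · rw [← hmn.sign, hm]
      ring
    · rw [← hmn.sinh, hm]
      ring

/-- The sign and the phase of the curvature are determined by the endpoint. -/
theorem sign_phase_unique {σ τ τ' ρ s₀ s₀' n n' : ℝ} (hσ : σ ^ 2 = 1) (hτ : τ ^ 2 = 1)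
    (hτ' : τ' ^ 2 = 1) (h1 : n ^ 2 * (ρ ^ 2 - 1) = σ * τ) (h2 : 2 * ρ * n ^ 2 = Real.sinh s₀)
    (h1' : n' ^ 2 * (ρ ^ 2 - 1) = σ * τ') (h2' : 2 * ρ * n' ^ 2 = Real.sinh s₀') :
    τ = τ' ∧ s₀ = s₀' := by
  have hst : σ * τ ≠ 0 := fun h => by
    have : (σ * τ) ^ 2 = 1 := by rw [mul_pow, hσ, hτ, one_mul]
    simp [h] at this
  have hρ : ρ ^ 2 - 1 ≠ 0 := fun h => hst (by rw [← h1, h, mul_zero])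
  have hn : n ≠ 0 := fun h => hst (by rw [← h1, h]; ring)
  have hττ : τ = τ' := by
    rcases sq_eq_sq_iff_eq_or_eq_neg.1 (hτ.trans hτ'.symm) with h | h
    · exact h
    · have : (n ^ 2 + n' ^ 2) * (ρ ^ 2 - 1) = 0 := by rw [add_mul, h1, h1', h]; ring
      exact absurd this (mul_ne_zero (by positivity) hρ)
  refine ⟨hττ, Real.sinh_injective ?_⟩
  have : n ^ 2 = n' ^ 2 := mul_right_cancel₀ hρ (by rw [h1, h1', hττ])
  rw [← h2, ← h2', this]

theorem toC_injective {γ η : ℝ → UpperHalfPlane} (h : toC η = toC γ) : η = γ :=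
  funext fun s => UpperHalfPlane.ext (congrFun h s)

/-- Existence and uniqueness of the elastica for endpoints other than `(±α, 0)`. -/
theorem exists_unique_asympGeodesic {α : ℝ} (hα : 0 < α) {x : ℝ} (hx : x ≠ α) (hx' : x ≠ -α) :
    ∃ γ : ℝ → UpperHalfPlane, IsFiniteElasticaTo α α x γ ∧ IsAsymptoticGeodesic γ ∧
      ∀ η : ℝ → UpperHalfPlane, IsFiniteElasticaTo α α x η → η = γ := by
  set ρ := x / α with hρdef
  have hρ : ρ ^ 2 - 1 ≠ 0 := fun h => by
    have h1 : (ρ - 1) * (ρ + 1) = 0 := by linear_combination h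
    have hxρ : x = ρ * α := by rw [hρdef, div_mul_cancel₀ _ hα.ne']
    rcases mul_eq_zero.1 h1 with h | h
    · exact hx (by rw [hxρ, sub_eq_zero.1 h, one_mul])
    · exact hx' (by rw [hxρ, eq_neg_of_add_eq_zero_left h, neg_one_mul])
  -- The parameters are forced: `m = ρ n` and `m² - n² = τ`.
  obtain ⟨τ, hτ, hτρ⟩ : ∃ τ : ℝ, τ ^ 2 = 1 ∧ 0 < τ * (ρ ^ 2 - 1) := by
    rcases lt_or_gt_of_ne hρ with h | h
    · exact ⟨-1, by norm_num, by linarith⟩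
    · exact ⟨1, by norm_num, by linarith⟩
  set n := (√(τ * (ρ ^ 2 - 1)))⁻¹ with hn
  have hnpos : 0 < n := inv_pos.2 (Real.sqrt_pos.2 hτρ)
  have hn2 : n ^ 2 * (ρ ^ 2 - 1) = τ := by
    have h1 : n ^ 2 * (τ * (ρ ^ 2 - 1)) = 1 := by
      rw [hn, inv_pow, Real.sq_sqrt hτρ.le, inv_mul_cancel₀ hτρ.ne']
    linear_combination τ * h1 - n ^ 2 * (ρ ^ 2 - 1) * hτ
  set s₀ := Real.arsinh (2 * (ρ * n) * n) with hs₀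
  have hsinh : Real.sinh s₀ = 2 * (ρ * n) * n := Real.sinh_arsinh _
  have hmn : IsRotationParam 1 τ s₀ (ρ * n) n := by
    refine ⟨by linear_combination hn2, hsinh.symm, ?_⟩
    refine (sq_eq_sq₀ (by positivity) (Real.cosh_pos _).le).1 ?_
    rw [Real.cosh_sq, hsinh, ← hτ, ← hn2]
    ring
  obtain ⟨ζ, hunit, hζ⟩ := isUnitSpeed_asympCurve hmn hα (one_pow 2) hτ
  let γ : ℝ → UpperHalfPlane := fun s => ⟨asympCurve α 1 τ s₀ (ρ * n) n s, hunit.im_pos s⟩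
  have hγ : toC γ = asympCurve α 1 τ s₀ (ρ * n) n := rfl
  rw [← hγ] at hunit
  have hfin : IsFiniteElasticaTo α (1 * α) x γ := by
    refine isFiniteElasticaTo_of_isUnitSpeed hunit (contDiff_asympCurve hmn hα (one_pow 2) hτ)
      (eulerLagrange_sech hτ s₀) (integrable_sech_sq s₀ hτ)
      (asympCurve_zero hmn hα (one_pow 2) hτ) hζ ?_
    have := tendsto_asympCurve (α := α) (σ := 1) (τ := τ) (s₀ := s₀) (m := ρ * n) (one_pow 2)
      hnpos.ne'
    rwa [show α * (ρ * n) / (1 * n) = x by rw [hρdef]; field_simp] at this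
  refine ⟨γ, by simpa using hfin, ⟨s₀, ?_⟩, fun η hη => ?_⟩
  · rw [hunit.curvature_eq]
    rcases mul_self_eq_one_iff.1 ((sq τ).symm.trans hτ) with h | h
    · exact .inl fun s => by simp [h]
    · exact .inr fun s => by simp [h]
  · obtain ⟨ζ', κ, h', hζ', ⟨-, h0⟩ | ⟨τ', s₀', n', hτ', rfl, h1, h2⟩⟩ :=
      IsFiniteElasticaTo.classification hα (one_pow 2) (by simpa using hη)
    · exact absurd (h0.trans (one_mul α)) hx
    · rw [one_mul] at h1 h2
      obtain ⟨rfl, rfl⟩ := sign_phase_unique (n' := n) (one_pow 2) hτ' hτ h1 h2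
        (by linear_combination hn2) (by linear_combination -hsinh)
      exact toC_injective (h'.unique hunit (fun s => abs_two_div_cosh_le _ hτ)
        (hη.start.trans hfin.start.symm) (hζ'.trans hζ.symm))

/-! ### The half circle -/

theorem geodesic_mem_circle (α : ℝ) {σ : ℝ} (hσ : σ ^ 2 = 1) (s : ℝ) :
    (geodesic α σ s).re ^ 2 + (geodesic α σ s).im ^ 2 = α ^ 2 := by
  simp only [geodesic, Complex.add_re, Complex.add_im, Complex.ofReal_re, Complex.ofReal_im,
      Complex.mul_re, Complex.mul_im, Complex.I_re, Complex.I_im]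
  have := Real.cosh_pos s
  field_simp
  ring_nf
  rw [hσ, Real.cosh_sq]
  ring

theorem exists_geodesic_eq {α σ : ℝ} (hα : 0 < α) (hσ : σ ^ 2 = 1) {z : ℂ} (hz : 0 < z.im)
    (h : z.re ^ 2 + z.im ^ 2 = α ^ 2) : ∃ s, geodesic α σ s = z := by
  refine ⟨Real.arsinh (σ * z.re / z.im), ?_⟩
  have hcosh : Real.cosh (Real.arsinh (σ * z.re / z.im)) = α / z.im := by
    refine (sq_eq_sq₀ (Real.cosh_pos _).le (by positivity)).1 ?_
    rw [Real.cosh_sq, Real.sinh_arsinh, div_pow, mul_pow, hσ, div_pow, ← h]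
    field_simp
  rw [geodesic, hcosh, Real.sinh_arsinh]
  apply Complex.ext
  · simp only [Complex.add_re, Complex.ofReal_re, Complex.ofReal_im, Complex.mul_re,
      Complex.I_re, Complex.I_im]
    field_simp
    linear_combination z.re * hσ
  · simp only [Complex.add_im, Complex.ofReal_re, Complex.ofReal_im, Complex.mul_im,
      Complex.I_re, Complex.I_im]
    field_simp
    ring

/-- A half circle through `(0, α)` ending at `(x, 0)` with `x² = α²` is centred at the origin. -/
theorem IsHalfCircleConnecting.eq {α x : ℝ} (hα : 0 < α) (hx : x ^ 2 = α ^ 2)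
    {D : Set UpperHalfPlane} (hD : IsHalfCircleConnecting α x D) :
    D = {z | z.re ^ 2 + z.im ^ 2 = α ^ 2} := by
  obtain ⟨⟨m, r, -, rfl⟩, ⟨z, hz, hzα⟩, hcl⟩ := hD
  have h1 : m ^ 2 + α ^ 2 = r ^ 2 := by
    have hre : z.re = 0 := congrArg Complex.re hzα
    have him : z.im = α := congrArg Complex.im hzα
    rw [mem_ofPred_eq, hre, him] at hz
    linarith
  have h2 : (x - m) ^ 2 = r ^ 2 := by
    have hclosed : IsClosed {w : ℂ | (w.re - m) ^ 2 + w.im ^ 2 = r ^ 2} :=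
      isClosed_eq (by fun_prop) continuous_const
    have := closure_minimal (image_subset_iff.2 fun w hw => hw) hclosed hcl
    simpa using this
  have hx0 : x ≠ 0 := fun h => by
    rw [h] at hx
    nlinarith
  have hm : m = 0 := by
    have : x * m = 0 := by linarith
    exact (mul_eq_zero.1 this).resolve_left hx0
  rw [hm] at h1 ⊢
  simp [← h1]

/-- The elastica with endpoint `(±α, 0)` and velocity pointing towards it is the geodesic. -/
theorem exists_unique_geodesic {α σ : ℝ} (hα : 0 < α) (hσ : σ ^ 2 = 1) :
    ∃ C : Set UpperHalfPlane, IsHalfCircleConnecting α (σ * α) C ∧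
      (∀ D : Set UpperHalfPlane, IsHalfCircleConnecting α (σ * α) D → D = C) ∧
      ∃ γ : ℝ → UpperHalfPlane, IsFiniteElasticaTo α (σ * α) (σ * α) γ ∧ range γ = C ∧
        ∀ η : ℝ → UpperHalfPlane, IsFiniteElasticaTo α (σ * α) (σ * α) η → η = γ := by
  have hunit := isUnitSpeed_geodesic hα hσ
  have hlim := tendsto_geodesic α σ
  have hstart : geodesic α σ 0 = ⟨0, α⟩ := by apply Complex.ext <;> simp [geodesic]
  let γ : ℝ → UpperHalfPlane := fun s => ⟨geodesic α σ s, hunit.im_pos s⟩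
  have hγ : toC γ = geodesic α σ := rfl
  have hmem : ∀ s, γ s ∈ {z : UpperHalfPlane | z.re ^ 2 + z.im ^ 2 = α ^ 2} :=
    geodesic_mem_circle α hσ
  have hfin : IsFiniteElasticaTo α (σ * α) (σ * α) γ :=
    isFiniteElasticaTo_of_isUnitSpeed (hγ ▸ hunit) (contDiff_geodesic α σ)
      (fun s => by simp [eulerLagrange]) (by simp) hstart (by simp) hlim
  refine ⟨{z | z.re ^ 2 + z.im ^ 2 = α ^ 2},
    ⟨⟨0, α, hα, by simp⟩, ⟨γ 0, hmem 0, hstart⟩, ?_⟩,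
    fun D hD => hD.eq hα (by rw [mul_pow, hσ, one_mul]), γ, hfin, ?_, fun η hη => ?_⟩
  · exact mem_closure_of_tendsto (x := (⟨σ * α, 0⟩ : ℂ)) hlim
      (.of_forall fun s => ⟨γ s, hmem s, rfl⟩)
  · refine Subset.antisymm (range_subset_iff.2 hmem) fun z hz => ?_
    obtain ⟨s, hs⟩ := exists_geodesic_eq hα hσ (z := z) z.im_pos hz
    exact ⟨s, UpperHalfPlane.ext hs⟩
  · obtain ⟨ζ, κ, h, hζ, ⟨rfl, -⟩ | ⟨τ, s₀, n, hτ, -, h1, -⟩⟩ := hη.classification hα hσ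
    · exact toC_injective (h.unique (hγ ▸ hunit) (by simp) (hη.start.trans hfin.start.symm)
        (by simp [hζ]))
    · -- The endpoint has `ρ = σ² = 1`, which no asymptotically geodesic elastica attains.
      have hρ : σ * (σ * α) / α = 1 := by
        field_simp
        exact hσ
      rw [hρ] at h1
      norm_num at h1
      rcases h1 with rfl | rfl
      · norm_num at hσ
      · norm_num at hτ

end HypElastica

theorem lemma3p2 (α : ℝ) (hα : 0 < α) :
    (∀ x : ℝ, x ≠ α → x ≠ -α →
      ∃ γ : ℝ → UpperHalfPlane,
        HypElastica.IsFiniteElasticaTo α α x γ ∧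
        HypElastica.IsAsymptoticGeodesic γ ∧
        ∀ η : ℝ → UpperHalfPlane, HypElastica.IsFiniteElasticaTo α α x η → η = γ) ∧
    (∀ x : ℝ, x = α ∨ x = -α →
      ∃ C : Set UpperHalfPlane,
        HypElastica.IsHalfCircleConnecting α x C ∧
        (∀ D : Set UpperHalfPlane, HypElastica.IsHalfCircleConnecting α x D → D = C) ∧
        ∃ γ : ℝ → UpperHalfPlane,
          HypElastica.IsFiniteElasticaTo α x x γ ∧
          Set.range γ = C ∧
          ∀ η : ℝ → UpperHalfPlane, HypElastica.IsFiniteElasticaTo α x x η → η = γ) := by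
  refine ⟨fun x hx hx' => HypElastica.exists_unique_asympGeodesic hα hx hx', fun x hx => ?_⟩
  obtain ⟨σ, hσ, rfl⟩ : ∃ σ : ℝ, σ ^ 2 = 1 ∧ x = σ * α := by
    rcases hx with rfl | rfl
    · exact ⟨1, by norm_num, by ring⟩
    · exact ⟨-1, by norm_num, by ring⟩
  exact HypElastica.exists_unique_geodesic hα hσ
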